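/- Let $p$ be a prime and let $S_p=\{(y_0,y_1,\dots)\in\mathbb T^{\infty}: y_j=y_{j+1}^p \text{ for all } j\ge 0\}$ be the $p$-adic solenoid, a compact abelian group (written additively, with neutral element $e=(1,1,\dots)$) with the topology induced from the product of circles. Its characters are $\chi_{d,\ell}(y)=y_d^{\ell}$ ($d\in\mathbb Z_{\ge 0}$, $\ell\in\mathbb Z$). Let $\arg:\mathbb T\to[-\pi,\pi)$ be given by $\arg(e^{ix})=x$ for $-\pi\le x<\pi$, and let $h:\mathbb R\to\mathbb R$ be given by $h(x)=-x-\pi$ for $-\pi\le x<-\pi/2$, $h(x)=x$ for $-\pi/2\le x<\pi/2$, $h(x)=-x+\pi$ for $\pi/2\le x<\pi$, and $h(x)=0$ otherwise. For $b\ge 0$ let $\psi_b(\chi_{d,\ell})=b\ell^2/p^{2d}$, and let $g_{S_p}(y,\chi_{d,\ell})=\ell\,h(\arg y_0)/p^d$. A (possibly infinite) Borel measure $\eta$ on $S_p$ is a Lévy measure if $\eta(\{e\})=0$, $\eta(S_p\setminus U)<\infty$ for every Borel neighbourhood $U$ of $e$, and $\int(1-\operatorname{Re}\chi)\,d\eta<\infty$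 for every character $\chi$. The measures $\gamma_{\psi_b}$ and $\pi_{\eta,g_{S_p}}$ are the probability measures on $S_p$ with Fourier transforms $\widehat\gamma_{\psi_b}(\chi)=e^{-\psi_b(\chi)/2}$ and $\widehat\pi_{\eta,g_{S_p}}(\chi)=\exp\int\big(\chi(x)-1-i\,g_{S_p}(x,\chi)\big)\,d\eta(x)$ for all characters $\chi$; both exist and are unique. Theorem (Gauss–Poisson limit theorem on the $p$-adic solenoid). Let $\{X_{n,k}: n\in\mathbb N,\ 1\le k\le K_n\}$ be a rowwise independent array of random elements of $S_p$. Suppose that there are $a=(a_0,a_1,\dots)\in S_p$, $b\ge 0$ and a Lévy measure $\eta$ on $S_p$ such that, as $n\to\infty$, (i) $\max_{1\le k\le K_n}\mathrm P\big(\exists\, j\le d: |\arg((X_{n,k})_j)|>\varepsilon\big)\to 0$ for all $d\in\mathbb Z_{\ge 0}$ and $\varepsilon>0$; (ii) $\exp\Big\{\frac{i}{p^d}\sum_{k=1}^{K_n}\mathrm E\,h(\arg((X_{n,k})_0))\Big\}\to a_d$ for all $d\in\mathbb Z_{\ge 0}$; (iii) $\sum_{k=1}^{K_n}\operatorname{Var}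 h(\arg((X_{n,k})_0))\to b+\int_{S_p}h(\arg y_0)^2\,d\eta(y)$; (iv) $\sum_{k=1}^{K_n}\mathrm E f(X_{n,k})\to\int_{S_p}f\,d\eta$ for every bounded continuous $f:S_p\to\mathbb R$ that vanishes on some neighbourhood of $e$. Then the array is infinitesimal, i.e. $\max_{1\le k\le K_n}\mathrm P(X_{n,k}\notin U)\to 0$ for every Borel neighbourhood $U$ of $e$, and the row sums $\sum_{k=1}^{K_n}X_{n,k}$ converge in distribution to $\delta_a*\gamma_{\psi_b}*\pi_{\eta,g_{S_p}}$. -/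

import Mathlib

open MeasureTheory ProbabilityTheory Filter Topology
open scoped BoundedContinuousFunction

/-! ### Measures on a topological abelian group

Groups are written multiplicatively, so the neutral element `e` is `1` and the sum of
group elements is a product. -/

section General

/-- The Fourier transform of a measure `μ` on `G`, as a function on the character group. -/
noncomputable def fourierTransform {G : Type*} [CommGroup G] [TopologicalSpace G]
    [MeasurableSpace G] (μ : Measure G) (χ : PontryaginDual G) : ℂ :=
  ∫ x, (χ x : ℂ) ∂μ

/-- A (possibly infinite) measure `η` on `G` is a Lévy measure if it has no mass at the neutral
element, is finite off every Borel neighbourhood of the neutral element, and integrates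
`1 - Re χ` for every character `χ`. -/
structure IsLevyMeasure {G : Type*} [CommGroup G] [TopologicalSpace G]
    [MeasurableSpace G] (η : Measure G) : Prop where
  measure_one : η {1} = 0
  measure_compl_lt_top : ∀ U : Set G, MeasurableSet U → U ∈ 𝓝 (1 : G) → η Uᶜ < ⊤
  lintegral_lt_top : ∀ χ : PontryaginDual G,
    ∫⁻ x, ENNReal.ofReal (1 - (χ x : ℂ).re) ∂η < ⊤

/-- `γ` is the symmetric Gauss measure with quadratic form `ψ`:
its Fourier transform is `exp (-ψ / 2)`. -/
def IsGaussMeasure {G : Type*} [CommGroup G] [TopologicalSpace G]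
    [MeasurableSpace G] (ψ : PontryaginDual G → ℝ) (γ : ProbabilityMeasure G) : Prop :=
  ∀ χ : PontryaginDual G,
    fourierTransform (γ : Measure G) χ = Complex.exp (-((ψ χ : ℝ) : ℂ) / 2)

/-- `π` is the generalized Poisson measure of the Lévy measure `η` with respect to the local
inner product `g`: its Fourier transform is `exp (∫ (χ x - 1 - i g(x, χ)) dη(x))`. -/
def IsGeneralizedPoisson {G : Type*} [CommGroup G] [TopologicalSpace G]
    [MeasurableSpace G] (η : Measure G) (g : G → PontryaginDual G → ℝ)
    (π : ProbabilityMeasure G) : Prop :=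
  ∀ χ : PontryaginDual G,
    fourierTransform (π : Measure G) χ =
      Complex.exp (∫ x, ((χ x : ℂ) - 1 - Complex.I * ((g x χ : ℝ) : ℂ)) ∂η)

/-- A triangular array `X n k`, `k < K n`, of random elements of `G` (the `n`-th row living on
the probability space `(Ω n, P n)`) is infinitesimal if
`max_k P (X n k ∉ U) → 0` for every Borel neighbourhood `U` of the neutral element. -/
def IsInfinitesimalArray {G : Type*} [CommGroup G] [TopologicalSpace G]
    [MeasurableSpace G] {Ω : ℕ → Type*} [∀ n, MeasurableSpace (Ω n)]
    (P : ∀ n, Measure (Ω n)) (K : ℕ → ℕ) (X : ∀ n, Fin (K n) → Ω n → G) : Prop :=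
  ∀ U : Set G, MeasurableSet U → U ∈ 𝓝 (1 : G) →
    Tendsto (fun n => ⨆ k : Fin (K n), P n {ω | X n k ω ∉ U}) atTop (𝓝 0)

end General

/-! ### The argument and the truncation function -/

/-- The argument of a point of the unit circle, with values in `[-π, π)`
(`Complex.arg` has values in `(-π, π]`). -/
noncomputable def circleArg (z : Circle) : ℝ :=
  if Complex.arg (z : ℂ) = Real.pi then -Real.pi else Complex.arg (z : ℂ)

/-- The truncation function `h`. -/
noncomputable def truncH (x : ℝ) : ℝ :=
  if x < -Real.pi ∨ Real.pi ≤ x then 0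
  else if x < -(Real.pi / 2) then -x - Real.pi
  else if x < Real.pi / 2 then x
  else -x + Real.pi

/-! ### The `p`-adic solenoid and its characters -/

/-- The `p`-adic solenoid: the sequences `(y₀, y₁, …)` on the circle with `y_j = y_{j+1} ^ p`,
with the topology and the Borel structure induced from the product of circles. -/
def solenoid (p : ℕ) : Subgroup (ℕ → Circle) where
  carrier := {y | ∀ j, y j = y (j + 1) ^ p}
  mul_mem' := by
    intro a b ha hb j
    simp only [Pi.mul_apply, mul_pow]
    rw [← ha j, ← hb j]
  one_mem' := by intro j; simp
  inv_mem' := by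
    intro a ha j
    simp only [Pi.inv_apply, inv_pow]
    rw [← ha j]

noncomputable instance instMeasurableSpaceSolenoid (p : ℕ) : MeasurableSpace (solenoid p) :=
  borel (solenoid p)

instance instBorelSpaceSolenoid (p : ℕ) : BorelSpace (solenoid p) := ⟨rfl⟩

instance instSecondCountableTopologySolenoid (p : ℕ) : SecondCountableTopology (solenoid p) :=
  TopologicalSpace.Subtype.secondCountableTopology {y : ℕ → Circle | y ∈ solenoid p}

/-- The character `χ_{d,ℓ}(y) = y_d ^ ℓ`. -/
noncomputable def solenoidChar (p d : ℕ) (l : ℤ) : PontryaginDual (solenoid p) :=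
  (⟨⟨⟨fun y => (y : ℕ → Circle) d ^ l, by simp⟩, by intro x y; simp [mul_zpow]⟩,
    by
      have h : Continuous fun y : solenoid p => (y : ℕ → Circle) d :=
        (continuous_apply d).comp continuous_subtype_val
      exact h.zpow l⟩ : solenoid p →ₜ* Circle)

@[simp]
theorem solenoidChar_apply (p d : ℕ) (l : ℤ) (y : solenoid p) :
    solenoidChar p d l y = (y : ℕ → Circle) d ^ l := rfl

/-- The one-parameter subgroup `t ↦ (exp (i t / p ^ j))_j` of the solenoid. -/
noncomputable def solenoidLine (p : ℕ) (hp : p ≠ 0) (t : ℝ) : solenoid p :=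
  ⟨fun j => Circle.exp (t / (p : ℝ) ^ j), by
    intro j
    have hp' : (p : ℝ) ≠ 0 := by exact_mod_cast hp
    rw [← Circle.exp_natCast_mul]
    rw [pow_succ]
    field_simp⟩

theorem solenoidLine_coe (p : ℕ) (hp : p ≠ 0) (t : ℝ) (j : ℕ) :
    (solenoidLine p hp t : ℕ → Circle) j = Circle.exp (t / (p : ℝ) ^ j) := rfl

theorem solenoidLine_add (p : ℕ) (hp : p ≠ 0) (s t : ℝ) :
    solenoidLine p hp (s + t) = solenoidLine p hp s * solenoidLine p hp t := by
  apply Subtype.ext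
  funext j
  simp [solenoidLine_coe, add_div, Circle.exp_add]

theorem continuous_solenoidLine (p : ℕ) (hp : p ≠ 0) : Continuous (solenoidLine p hp) := by
  refine Continuous.subtype_mk (continuous_pi fun j => ?_) _
  exact Circle.exp.continuous.comp (continuous_id.div_const _)

/-- A continuous homomorphism from `ℝ` to the circle is `t ↦ exp (i c t)`. -/
theorem exists_frequency_of_hom (φ : ℝ → Circle) (hc : Continuous φ)
    (hadd : ∀ s t, φ (s + t) = φ s * φ t) : ∃ c : ℝ, ∀ t, φ t = Circle.exp (c * t) := by
  let f : ℝ → ℂ := fun t => (φ t : ℂ)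
  have hf : Continuous f := continuous_subtype_val.comp hc
  have h0 : φ 0 = 1 := by
    have := hadd 0 0
    simpa using this
  have hfadd : ∀ s t, f (s + t) = f s * f t := fun s t => by
    simp [f, hadd]
  let F : ℝ → ℂ := fun x => ∫ t in (0 : ℝ)..x, f t
  have hF : ∀ x, HasDerivAt F (f x) x := fun x => hf.integral_hasStrictDerivAt 0 x |>.hasDerivAt
  obtain ⟨a, ha⟩ : ∃ a, F a ≠ 0 := by
    by_contra! h
    have h1 : F = fun _ => 0 := funext h
    have h2 := hF 0
    rw [h1] at h2
    have h3 := h2.unique (hasDerivAt_const (0 : ℝ) (0 : ℂ))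
    simp [f, h0] at h3
  have key : ∀ t, f t = (F (t + a) - F t) / F a := by
    intro t
    rw [eq_div_iff ha]
    have e1 : F (t + a) - F t = ∫ s in t..(t + a), f s :=
      intervalIntegral.integral_interval_sub_left (hf.intervalIntegrable _ _)
        (hf.intervalIntegrable _ _)
    rw [e1]
    have e2 : ∫ s in t..(t + a), f s = ∫ s in (0 : ℝ)..a, f (t + s) := by
      rw [intervalIntegral.integral_comp_add_left]
      simp
    rw [e2]
    simp only [hfadd, F]
    rw [intervalIntegral.integral_const_mul]
  let κ : ℂ := (f a - 1) / F a
  have hder : ∀ t, HasDerivAt f (κ * f t) t := by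
    intro t
    have h1 : HasDerivAt (fun t => (F (t + a) - F t) / F a) ((f (t + a) - f t) / F a) t :=
      (((hF (t + a)).comp_add_const t a).sub (hF t)).div_const _
    have h2 : f = fun t => (F (t + a) - F t) / F a := funext key
    have h3 : (f (t + a) - f t) / F a = κ * f t := by
      simp only [κ, hfadd]
      ring
    rw [h3, ← h2] at h1
    exact h1
  have hconst : ∀ t : ℝ, f t * Complex.exp (-(κ * t)) = 1 := by
    have hd : ∀ t : ℝ, HasDerivAt (fun t : ℝ => f t * Complex.exp (-(κ * t))) 0 t := by
      intro t
      have h1 : HasDerivAt (fun t : ℝ => -(κ * (t : ℂ))) (-κ) t := by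
        simpa using ((Complex.ofRealCLM.hasDerivAt (x := t)).const_mul κ).fun_neg
      exact ((hder t).fun_mul h1.cexp).congr_deriv (by ring)
    intro t
    have h3 := is_const_of_deriv_eq_zero (fun t => (hd t).differentiableAt)
      (fun t => (hd t).deriv) t 0
    simpa [f, h0] using h3
  have hexp : ∀ t : ℝ, f t = Complex.exp (κ * t) := by
    intro t
    have h1 := hconst t
    rw [Complex.exp_neg] at h1
    field_simp at h1
    exact h1
  have hre : κ.re = 0 := by
    have h1 : ‖f 1‖ = 1 := Circle.norm_coe _
    rw [hexp 1, Complex.norm_exp] at h1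
    simpa using h1
  refine ⟨κ.im, fun t => Circle.ext ?_⟩
  have h1 : κ = κ.im * Complex.I := by
    apply Complex.ext <;> simp [hre]
  rw [Circle.coe_exp]
  change f t = _
  rw [hexp t]
  conv_lhs => rw [h1]
  congr 1
  push_cast
  ring

/-- Every character of the solenoid is one of the `χ_{d,ℓ}`. -/
theorem exists_eq_solenoidChar (p : ℕ) (hp : p ≠ 0) (χ : PontryaginDual (solenoid p)) :
    ∃ (d : ℕ) (l : ℤ), χ = solenoidChar p d l := by
  have hp' : (p : ℝ) ≠ 0 := by exact_mod_cast hp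
  have hχ : Continuous χ := map_continuous χ
  obtain ⟨c, hc⟩ := exists_frequency_of_hom (fun t => χ (solenoidLine p hp t))
    (hχ.comp (continuous_solenoidLine p hp))
    (fun s t => by rw [solenoidLine_add, map_mul])
  obtain ⟨d, hd⟩ : ∃ d : ℕ, ∀ y : solenoid p, (y : ℕ → Circle) d = 1 → χ y = 1 := by
    have hV : χ ⁻¹' (Circle.centeredArc (Real.pi / 2)) ∈ 𝓝 (1 : solenoid p) := by
      refine ((Circle.isOpen_centeredArc _).preimage hχ).mem_nhds ?_
      rw [Set.mem_preimage, map_one, Circle.mem_centeredArc (by linarith [Real.pi_pos])]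
      simp [Real.pi_pos]
    rw [nhds_subtype_eq_comap, Filter.mem_comap] at hV
    obtain ⟨W, hW, hWV⟩ := hV
    rw [nhds_pi, Filter.mem_pi] at hW
    obtain ⟨I, hI, t, ht, htW⟩ := hW
    obtain ⟨d, hd⟩ := hI.bddAbove
    refine ⟨d, fun y hy => ?_⟩
    have hdown : ∀ m j : ℕ, j + m = d → (y : ℕ → Circle) j = 1 := by
      intro m
      induction m with
      | zero => intro j hj; rw [← hy, ← hj, add_zero]
      | succ m ih =>
        intro j hj
        rw [y.2 j, ih (j + 1) (by omega), one_pow]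
    have hker : ∀ j ∈ I, (y : ℕ → Circle) j = 1 := fun j hj =>
      hdown (d - j) j (by have := hd hj; omega)
    refine Circle.eq_one_of_forall_pow_mem_centeredArc_pi_div_two fun n _ => ?_
    rw [← map_pow]
    apply hWV
    apply htW
    intro j hj
    have : ((y ^ n : solenoid p) : ℕ → Circle) j = 1 := by
      simp [hker j hj]
    rw [this]
    exact mem_of_mem_nhds (ht j)
  have h1 : χ (solenoidLine p hp (2 * Real.pi * (p : ℝ) ^ d)) = 1 := by
    apply hd
    rw [solenoidLine_coe]
    rw [mul_div_assoc, div_self (pow_ne_zero _ hp'), mul_one, Circle.exp_two_pi]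
  rw [hc] at h1
  obtain ⟨l, hl⟩ := Circle.exp_eq_one.mp h1
  have hcl : c * (p : ℝ) ^ d = l := by
    have : (2 * Real.pi) ≠ 0 := by positivity
    apply mul_right_cancel₀ this
    linarith
  refine ⟨d, l, PontryaginDual.ext fun y => ?_⟩
  obtain ⟨s, hs⟩ : ∃ s : ℝ, (y : ℕ → Circle) d = Circle.exp s :=
    ⟨Complex.arg ((y : ℕ → Circle) d : ℂ), (Circle.exp_arg _).symm⟩
  have h2 : χ (y * (solenoidLine p hp ((p : ℝ) ^ d * s))⁻¹) = 1 := by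
    apply hd
    simp only [Subgroup.coe_mul, Subgroup.coe_inv, Pi.mul_apply, Pi.inv_apply, solenoidLine_coe]
    rw [mul_div_cancel_left₀ _ (pow_ne_zero _ hp'), hs, mul_inv_cancel]
  rw [map_mul, map_inv, mul_inv_eq_one, hc] at h2
  rw [h2, solenoidChar_apply, hs, ← Circle.exp_intCast_mul]
  congr 1
  rw [← hcl]
  ring

/-- The number `ℓ / p ^ d` attached to a character `χ = χ_{d,ℓ}`. -/
noncomputable def solenoidFreq (p : ℕ) [hp : Fact p.Prime] (χ : PontryaginDual (solenoid p)) : ℝ :=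
  ((exists_eq_solenoidChar p hp.out.ne_zero χ).choose_spec.choose : ℝ) /
    (p : ℝ) ^ (exists_eq_solenoidChar p hp.out.ne_zero χ).choose

/-- `ℓ / p ^ d` depends only on the character `χ_{d,ℓ}`. -/
theorem div_eq_div_of_solenoidChar_eq (p : ℕ) (hp : p ≠ 0) (d d' : ℕ) (l l' : ℤ)
    (h : solenoidChar p d l = solenoidChar p d' l') :
    (l : ℝ) / (p : ℝ) ^ d = (l' : ℝ) / (p : ℝ) ^ d' := by
  have h1 : ∀ t : ℝ, Circle.exp (((l : ℝ) / (p : ℝ) ^ d - (l' : ℝ) / (p : ℝ) ^ d') * t) = 1 := by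
    intro t
    have h2 := DFunLike.congr_fun h (solenoidLine p hp t)
    simp only [solenoidChar_apply, solenoidLine_coe] at h2
    rw [← Circle.exp_intCast_mul, ← Circle.exp_intCast_mul] at h2
    rw [sub_mul, Circle.exp_sub, div_eq_one]
    convert h2 using 2 <;> ring
  by_contra hne
  have hne' := sub_ne_zero.mpr hne
  have h3 := h1 (Real.pi / ((l : ℝ) / (p : ℝ) ^ d - (l' : ℝ) / (p : ℝ) ^ d'))
  rw [mul_div_cancel₀ _ hne'] at h3
  exact Circle.exp_pi_ne_one h3

theorem solenoidFreq_solenoidChar (p : ℕ) [hp : Fact p.Prime] (d : ℕ) (l : ℤ) :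
    solenoidFreq p (solenoidChar p d l) = (l : ℝ) / (p : ℝ) ^ d :=
  (div_eq_div_of_solenoidChar_eq p hp.out.ne_zero _ _ _ _
    (exists_eq_solenoidChar p hp.out.ne_zero (solenoidChar p d l)).choose_spec.choose_spec).symm

/-- The quadratic form `ψ_b (χ_{d,ℓ}) = b ℓ ^ 2 / p ^ (2 d)`. -/
noncomputable def solenoidQuadraticForm (p : ℕ) [Fact p.Prime] (b : ℝ)
    (χ : PontryaginDual (solenoid p)) : ℝ :=
  b * solenoidFreq p χ ^ 2

theorem solenoidQuadraticForm_solenoidChar (p : ℕ) [Fact p.Prime] (b : ℝ) (d : ℕ) (l : ℤ) :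
    solenoidQuadraticForm p b (solenoidChar p d l) = b * (l : ℝ) ^ 2 / (p : ℝ) ^ (2 * d) := by
  rw [solenoidQuadraticForm, solenoidFreq_solenoidChar, div_pow, ← pow_mul, mul_comm d 2,
    mul_div_assoc]

/-- The local inner product `g (y, χ_{d,ℓ}) = ℓ h(arg y₀) / p ^ d`. -/
noncomputable def solenoidInner (p : ℕ) [Fact p.Prime] (y : solenoid p)
    (χ : PontryaginDual (solenoid p)) : ℝ :=
  solenoidFreq p χ * truncH (circleArg ((y : ℕ → Circle) 0))

theorem solenoidInner_solenoidChar (p : ℕ) [Fact p.Prime] (y : solenoid p) (d : ℕ) (l : ℤ) :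
    solenoidInner p y (solenoidChar p d l) =
      (l : ℝ) * truncH (circleArg ((y : ℕ → Circle) 0)) / (p : ℝ) ^ d := by
  rw [solenoidInner, solenoidFreq_solenoidChar, div_mul_eq_mul_div]

/-!
The Fourier transform embeds the probability measures on a compact Polish group whose characters
separate points as a closed set of functions on the dual. It therefore suffices to show, for each
character `χ`, that the products of the Fourier transforms of the entries of a row converge. Let
`Z = g (·, χ)`, a continuous function with `χ = exp (i Z)` near the neutral element. If `m` is the
mean of `Z` at an entry `x`, then `E χ(x) exp (-i m) - 1` is `-Var Z(x) / 2` plus the expectation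
of a remainder which is `o((Z - m)²)` near the neutral element. By vague convergence off the neutral
element the remainders of a row add up to `∫ (χ - 1 - i Z + Z² / 2) dη` in the limit, and the
variances to `v + ∫ Z² dη`, where `v` is the value of the Gaussian form at `χ`. Hence the centred
products converge to `exp (-v / 2 + ∫ (χ - 1 - i Z) dη)`, and the centring factors to `χ a`.

The generalized Poisson measure exists because the closed set of Fourier transforms contains those
of shifted compound Poisson measures, obtained by restricting `η` to complements of neighbourhoods
of the neutral element.
-/

section Rows

variable {ι : Type*} {L : Filter ι} {κ : ι → Type*}

/-- The filter on the index set of an array with rows `κ n`, `n : ι`, along which convergence is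
convergence as `n` tends along `L`, uniformly within the rows. -/
def rowFilter (L : Filter ι) (κ : ι → Type*) : Filter (Σ n, κ n) :=
  L.comap Sigma.fst

theorem eventually_rowFilter {p : (Σ n, κ n) → Prop} :
    (∀ᶠ s in rowFilter L κ, p s) ↔ ∀ᶠ n in L, ∀ k, p ⟨n, k⟩ := by
  simp only [rowFilter, eventually_comap]
  refine eventually_congr (.of_forall fun n => ⟨fun h k => h ⟨n, k⟩ rfl, ?_⟩)
  rintro h ⟨n, k⟩ rfl
  exact h k

variable [∀ n, Fintype (κ n)]

theorem tendsto_sum_zero_of_isLittleO {E F : Type*} [NormedAddCommGroup E] [NormedAddCommGroup F]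
    {u : (Σ n, κ n) → E} {v : (Σ n, κ n) → F} (huv : u =o[rowFilter L κ] v)
    (hv : IsBoundedUnder (· ≤ ·) L fun n => ∑ k, ‖v ⟨n, k⟩‖) :
    Tendsto (fun n => ∑ k, u ⟨n, k⟩) L (𝓝 0) := by
  have hsum : (fun n => ∑ k, u ⟨n, k⟩) =o[L] fun n => ∑ k, ‖v ⟨n, k⟩‖ := by
    refine .of_bound fun ε hε => ?_
    filter_upwards [eventually_rowFilter.mp (huv.bound hε)] with n hn
    calc ‖∑ k, u ⟨n, k⟩‖ ≤ ∑ k, ε * ‖v ⟨n, k⟩‖ := norm_sum_le_of_le _ fun k _ => hn k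
      _ ≤ ε * ‖∑ k, ‖v ⟨n, k⟩‖‖ := by
        rw [← Finset.mul_sum]
        gcongr
        exact Real.le_norm_self _
  have hbdd : (fun n => ∑ k, ‖v ⟨n, k⟩‖) =O[L] (1 : ι → ℝ) := by
    refine (hv.mono_le <| .of_forall fun n => ?_).isBigO_one ℝ
    exact (Real.norm_of_nonneg (Finset.sum_nonneg fun k _ => norm_nonneg _)).le
  exact (hsum.trans_isBigO hbdd).tendsto_zero_of_tendsto tendsto_const_nhds

theorem tendsto_prod_exp_of_tendsto_sum_sub_one {z : (Σ n, κ n) → ℂ} {w : ℂ}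
    (hz : Tendsto z (rowFilter L κ) (𝓝 1))
    (hbdd : IsBoundedUnder (· ≤ ·) L fun n => ∑ k, ‖z ⟨n, k⟩ - 1‖)
    (hsum : Tendsto (fun n => ∑ k, (z ⟨n, k⟩ - 1)) L (𝓝 w)) :
    Tendsto (fun n => ∏ k, z ⟨n, k⟩) L (𝓝 (Complex.exp w)) := by
  have hlog_littleO :
      (fun s => Complex.log (z s) - (z s - 1)) =o[rowFilter L κ] fun s => z s - 1 := by
    have hderiv := (Complex.hasDerivAt_log (Complex.one_mem_slitPlane)).isLittleO
    simpa [Function.comp_def] using hderiv.comp_tendsto hz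
  have hlog : Tendsto (fun n => ∑ k, Complex.log (z ⟨n, k⟩)) L (𝓝 w) := by
    simpa [← Finset.sum_add_distrib] using
      (tendsto_sum_zero_of_isLittleO hlog_littleO hbdd).add hsum
  refine (Complex.continuous_exp.tendsto w |>.comp hlog).congr' ?_
  filter_upwards [eventually_rowFilter.mp (hz.eventually_ne one_ne_zero)] with n hn
  rw [Function.comp_apply, Complex.exp_sum]
  exact Finset.prod_congr rfl fun k _ => Complex.exp_log (hn k)

end Rows

section AwayFromPoint

theorem exists_continuous_cutoff {G : Type*} [TopologicalSpace G] [T4Space G] {e : G} {U : Set G}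
    (hU : U ∈ 𝓝 e) :
    ∃ φ : C(G, ℝ), φ =ᶠ[𝓝 e] 0 ∧ (∀ y ∉ U, φ y = 1) ∧ ∀ y, φ y ∈ Set.Icc (0 : ℝ) 1 := by
  obtain ⟨V, hV, hVclosed, hVU⟩ := exists_mem_nhds_isClosed_subset (interior_mem_nhds.mpr hU)
  obtain ⟨φ, hφ0, hφ1, hφ⟩ := exists_continuous_zero_one_of_isClosed hVclosed
    isOpen_interior.isClosed_compl (Set.disjoint_compl_right_iff_subset.mpr hVU)
  exact ⟨φ, eventually_of_mem hV hφ0, fun y hy => hφ1 fun h => hy (interior_subset h), hφ⟩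

variable {G : Type*} [TopologicalSpace G] [MeasurableSpace G] {e : G}

/-- A measure that is finite off every neighbourhood of the point `e`, like a Lévy measure off the
neutral element. -/
def IsFiniteAwayFrom (e : G) (η : Measure G) : Prop :=
  ∀ U ∈ 𝓝 e, η Uᶜ < ⊤

/-- The row sums of the measures `ν ⟨n, k⟩` converge to `η` vaguely on the complement of `e`: this
is the convergence of the integrals of continuous functions that vanish near `e`. -/
def TendstoAwayFrom {ι : Type*} {κ : ι → Type*} [∀ n, Fintype (κ n)] (L : Filter ι) (e : G)
    (ν : (Σ n, κ n) → Measure G) (η : Measure G) : Prop :=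
  ∀ f : C(G, ℝ), f =ᶠ[𝓝 e] 0 →
    Tendsto (fun n => ∑ k, ∫ y, f y ∂ν ⟨n, k⟩) L (𝓝 (∫ y, f y ∂η))

theorem norm_integral_sub_integral_cutoff_le [OpensMeasurableSpace G] {E : Type*}
    [NormedAddCommGroup E] [NormedSpace ℝ E] {μ : Measure G} {F : G → E} {q : G → ℝ} {φ : C(G, ℝ)}
    {ε : ℝ} (hF : Integrable F μ) (hq : Integrable q μ) (hφ : ∀ y, φ y ∈ Set.Icc (0 : ℝ) 1)
    (hε : 0 ≤ ε) (hFq : ∀ y, φ y ≠ 1 → ‖F y‖ ≤ ε * ‖q y‖) :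
    ‖∫ y, F y ∂μ - ∫ y, φ y • F y ∂μ‖ ≤ ε * ∫ y, ‖q y‖ ∂μ := by
  have hφF : Integrable (fun y => φ y • F y) μ :=
    hF.bdd_smul 1 φ.continuous.aestronglyMeasurable <| .of_forall fun y => by
      rw [Real.norm_of_nonneg (hφ y).1]
      exact (hφ y).2
  rw [← integral_sub hF hφF, ← integral_const_mul]
  refine norm_integral_le_of_norm_le (hq.norm.const_mul ε) (.of_forall fun y => ?_)
  by_cases hy : φ y = 1
  · simpa [hy] using by positivity
  · calc ‖F y - φ y • F y‖ = (1 - φ y) * ‖F y‖ := by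
          rw [← one_smul ℝ (F y), smul_smul, mul_one, ← sub_smul, norm_smul,
            Real.norm_of_nonneg (sub_nonneg.mpr (hφ y).2), one_smul]
      _ ≤ 1 * ‖F y‖ := by gcongr; linarith [(hφ y).1]
      _ ≤ ε * ‖q y‖ := by rw [one_mul]; exact hFq y hy

variable [CompactSpace G]

theorem integrable_of_continuous [OpensMeasurableSpace G] {E : Type*} [NormedAddCommGroup E]
    {μ : Measure G} [IsFiniteMeasureOnCompacts μ] {f : G → E} (hf : Continuous f) :
    Integrable f μ :=
  hf.integrable_of_hasCompactSupport (.of_compactSpace f)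

theorem IsFiniteAwayFrom.integrable_of_isBigO [BorelSpace G] {E F : Type*} [NormedAddCommGroup E]
    [NormedAddCommGroup F] {η : Measure G} (hη : IsFiniteAwayFrom e η) {f : G → E} {r : G → F}
    (hf : Continuous f) (hfr : f =O[𝓝 e] r) (hr : Integrable r η) : Integrable f η := by
  have hmeas : AEStronglyMeasurable f η :=
    (hf.stronglyMeasurable_of_hasCompactSupport (.of_compactSpace f)).aestronglyMeasurable
  obtain ⟨U, hU, hfU⟩ := hfr.integrableAtFilter ⟨_, univ_mem, hmeas.restrict⟩
    (hr.integrableAtFilter _)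
  obtain ⟨C, hC⟩ := isCompact_univ.exists_bound_of_continuousOn hf.continuousOn
  have hfUc : IntegrableOn f Uᶜ η :=
    Measure.integrableOn_of_bounded (hη U hU).ne hmeas (.of_forall fun y => hC y (Set.mem_univ y))
  simpa using hfU.union hfUc

namespace TendstoAwayFrom

variable [BorelSpace G] {ι : Type*} {κ : ι → Type*} [∀ n, Fintype (κ n)]
  {L : Filter ι} {ν : (Σ n, κ n) → Measure G} [∀ s, IsFiniteMeasure (ν s)] {η : Measure G}
  {𝕜 : Type*} [RCLike 𝕜]

theorem tendsto_sum_integral (hνη : TendstoAwayFrom L e ν η) (hη : IsFiniteAwayFrom e η)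
    {f : G → 𝕜} (hf : Continuous f) (hf0 : f =ᶠ[𝓝 e] 0) :
    Tendsto (fun n => ∑ k, ∫ y, f y ∂ν ⟨n, k⟩) L (𝓝 (∫ y, f y ∂η)) := by
  have hint : Integrable f η := hη.integrable_of_isBigO hf
    (hf0.trans_isBigO (Asymptotics.isBigO_zero (E' := 𝕜) (0 : G → 𝕜) _)) (integrable_zero _ _ _)
  have hre := hνη ⟨_, RCLike.continuous_re.comp hf⟩ (hf0.mono fun y hy => by simp [hy])
  have him := hνη ⟨_, RCLike.continuous_im.comp hf⟩ (hf0.mono fun y hy => by simp [hy])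
  have hsum := ((RCLike.continuous_ofReal (K := 𝕜)).tendsto _ |>.comp hre).add
    (((RCLike.continuous_ofReal (K := 𝕜)).tendsto _ |>.comp him).mul_const RCLike.I)
  simp only [ContinuousMap.coe_mk, Function.comp_apply] at hsum
  rw [integral_re_add_im hint] at hsum
  refine hsum.congr fun n => ?_
  rw [RCLike.ofReal_sum, RCLike.ofReal_sum, Finset.sum_mul, ← Finset.sum_add_distrib]
  exact Finset.sum_congr rfl fun k _ => integral_re_add_im (integrable_of_continuous hf)

theorem tendsto_sum_integral_cutoff (hνη : TendstoAwayFrom L e ν η) (hη : IsFiniteAwayFrom e η)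
    {F : (Σ n, κ n) → G → 𝕜} {f : G → 𝕜} (hF : ∀ s, Continuous (F s)) (hf : Continuous f)
    (hFf : TendstoUniformly F f (rowFilter L κ)) {φ : C(G, ℝ)} (hφ : φ =ᶠ[𝓝 e] 0) :
    Tendsto (fun n => ∑ k, ∫ y, φ y • F ⟨n, k⟩ y ∂ν ⟨n, k⟩) L (𝓝 (∫ y, φ y • f y ∂η)) := by
  have hmain := hνη.tendsto_sum_integral hη (f := fun y => φ y • f y) (φ.continuous.smul hf)
    (hφ.mono fun y hy => by simp [hy])
  have hbdd : IsBoundedUnder (· ≤ ·) L fun n => ∑ k, ‖∫ y, ‖φ y‖ ∂ν ⟨n, k⟩‖ := by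
    have habs := hνη ⟨fun y => ‖φ y‖, φ.continuous.norm⟩ (hφ.mono fun y hy => by simp [hy])
    simp only [Real.norm_of_nonneg (integral_nonneg fun y => norm_nonneg (φ y))]
    exact habs.isBoundedUnder_le
  have hdiff : (fun s => ∫ y, φ y • (F s y - f y) ∂ν s) =o[rowFilter L κ]
      fun s => ∫ y, ‖φ y‖ ∂ν s := by
    refine .of_bound fun ε hε => ?_
    filter_upwards [Metric.tendstoUniformly_iff.mp hFf ε hε] with s hs
    rw [Real.norm_of_nonneg (integral_nonneg fun y => norm_nonneg (φ y)), ← integral_const_mul]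
    refine norm_integral_le_of_norm_le
      ((integrable_of_continuous φ.continuous.norm).const_mul ε) (.of_forall fun y => ?_)
    rw [norm_smul, mul_comm, ← dist_eq_norm, dist_comm]
    gcongr
    exact (hs y).le
  have hsum := hmain.add (tendsto_sum_zero_of_isLittleO hdiff hbdd)
  rw [add_zero] at hsum
  refine hsum.congr fun n => ?_
  rw [← Finset.sum_add_distrib]
  refine Finset.sum_congr rfl fun k _ => ?_
  have hφf : Integrable (fun y => φ y • f y) (ν ⟨n, k⟩) :=
    integrable_of_continuous (φ.continuous.smul hf)
  have hφF : Integrable (fun y => φ y • F ⟨n, k⟩ y) (ν ⟨n, k⟩) :=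
    integrable_of_continuous (φ.continuous.smul (hF _))
  simp only [smul_sub]
  rw [integral_sub hφF hφf, add_sub_cancel]

theorem tendsto_sum_integral_of_isLittleO [T2Space G] (hνη : TendstoAwayFrom L e ν η)
    (hη : IsFiniteAwayFrom e η) {F : (Σ n, κ n) → G → 𝕜} {f : G → 𝕜} {q : (Σ n, κ n) → G → ℝ}
    {r : G → ℝ} (hF : ∀ s, Continuous (F s)) (hf : Continuous f)
    (hFf : TendstoUniformly F f (rowFilter L κ))
    (hFq : (fun x : (Σ n, κ n) × G => F x.1 x.2) =o[rowFilter L κ ×ˢ 𝓝 e] fun x => q x.1 x.2)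
    (hfr : f =o[𝓝 e] r) (hq : ∀ s, Integrable (q s) (ν s)) (hr : Integrable r η)
    (hbdd : IsBoundedUnder (· ≤ ·) L fun n => ∑ k, ∫ y, ‖q ⟨n, k⟩ y‖ ∂ν ⟨n, k⟩) :
    Tendsto (fun n => ∑ k, ∫ y, F ⟨n, k⟩ y ∂ν ⟨n, k⟩) L (𝓝 (∫ y, f y ∂η)) := by
  obtain ⟨B, hB⟩ := hbdd.eventually_le
  set R := ∫ y, ‖r y‖ ∂η
  have : 0 ≤ R := integral_nonneg fun y => norm_nonneg _
  refine Metric.tendsto_nhds.mpr fun ε hε => ?_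
  obtain ⟨δ, hδ, hδε⟩ : ∃ δ > 0, δ * |B| + δ * R < ε / 2 :=
    ⟨ε / 2 / (|B| + R + 1), by positivity, by
      rw [← mul_add, div_mul_eq_mul_div, div_lt_iff₀ (by positivity)]
      nlinarith⟩
  obtain ⟨pa, hpa, pb, hpb, hpab⟩ := eventually_prod_iff.mp (hFq.bound hδ)
  obtain ⟨φ, hφ0, hφ1, hφ⟩ := exists_continuous_cutoff (hpb.and (hfr.bound hδ))
  have hnear {y : G} (hy : φ y ≠ 1) : pb y ∧ ‖f y‖ ≤ δ * ‖r y‖ := by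
    by_contra h
    exact hy (hφ1 y h)
  have hfφ : ‖∫ y, f y ∂η - ∫ y, φ y • f y ∂η‖ ≤ δ * R :=
    norm_integral_sub_integral_cutoff_le (hη.integrable_of_isBigO hf hfr.isBigO hr) hr hφ hδ.le
      fun y hy => (hnear hy).2
  have hfar := Metric.tendsto_nhds.mp
    (hνη.tendsto_sum_integral_cutoff hη hF hf hFf hφ0) (ε / 2) (half_pos hε)
  filter_upwards [hfar, hB, eventually_rowFilter.mp hpa] with n hfar hBn hpan
  have hFφ : ‖∑ k, ∫ y, F ⟨n, k⟩ y ∂ν ⟨n, k⟩ - ∑ k, ∫ y, φ y • F ⟨n, k⟩ y ∂ν ⟨n, k⟩‖ ≤ δ * |B| :=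
    calc _ ≤ ∑ k, δ * ∫ y, ‖q ⟨n, k⟩ y‖ ∂ν ⟨n, k⟩ := by
          rw [← Finset.sum_sub_distrib]
          exact norm_sum_le_of_le _ fun k _ => norm_integral_sub_integral_cutoff_le
            (integrable_of_continuous (hF _)) (hq _) hφ hδ.le
            fun y hy => hpab (hpan k) (hnear hy).1
      _ ≤ δ * |B| := by
          rw [← Finset.mul_sum]
          gcongr
          exact hBn.trans (le_abs_self B)
  rw [← dist_eq_norm] at hFφ hfφ
  calc _ ≤ _ := dist_triangle4_right _ _ _ _
    _ < ε := by linarith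

end TendstoAwayFrom

end AwayFromPoint

section CentredRemainder

variable {G : Type*}

/-- The error of the approximation `1 + i (Z - m) - (Z - m)² / 2` to `exp (-i m) χ`, which is of
small order near the points around which `χ = exp (i Z)`. Centring at the mean `m` of `Z` turns the
quadratic term into a variance and makes the linear term disappear. -/
noncomputable def centredRemainder (χ : G → ℂ) (Z : G → ℝ) (m : ℝ) (y : G) : ℂ :=
  Complex.exp (-(Complex.I * m)) * χ y - 1 - Complex.I * (Z y - m) + (Z y - m) ^ 2 / 2

theorem integral_centredRemainder [MeasurableSpace G] {μ : Measure G} [IsProbabilityMeasure μ]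
    {χ : G → ℂ} {Z : G → ℝ} (hχ : Integrable χ μ) (hZ : MemLp Z 2 μ) :
    ∫ y, centredRemainder χ Z μ[Z] y ∂μ =
      Complex.exp (-(Complex.I * (μ[Z] : ℝ))) * ∫ y, χ y ∂μ - 1 + Var[Z; μ] / 2 := by
  have hlin : Integrable (fun y => ((Z y - μ[Z] : ℝ) : ℂ)) μ :=
    ((hZ.integrable one_le_two).sub (integrable_const _)).ofReal
  have hsq : Integrable (fun y => (((Z y - μ[Z]) ^ 2 : ℝ) : ℂ)) μ :=
    (hZ.sub (memLp_const _)).integrable_sq.ofReal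
  have hlin_zero : ∫ y, ((Z y - μ[Z] : ℝ) : ℂ) ∂μ = 0 := by
    rw [integral_complex_ofReal, integral_sub (hZ.integrable one_le_two) (integrable_const _),
      integral_const, probReal_univ, one_smul, sub_self, Complex.ofReal_zero]
  have hvar : (Var[Z; μ] : ℂ) = ∫ y, (((Z y - μ[Z]) ^ 2 : ℝ) : ℂ) ∂μ := by
    rw [variance_eq_integral hZ.aestronglyMeasurable.aemeasurable, integral_complex_ofReal]
  have hχ_int := hχ.const_mul (Complex.exp (-(Complex.I * (μ[Z] : ℝ))))
  have hχ_sub_one := hχ_int.sub' (integrable_const 1)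
  have hI_lin := hlin.const_mul Complex.I
  simp only [centredRemainder, ← Complex.ofReal_sub, ← Complex.ofReal_pow]
  rw [integral_add (hχ_sub_one.sub' hI_lin) (hsq.div_const 2), integral_sub hχ_sub_one hI_lin,
    integral_sub hχ_int (integrable_const _), integral_const_mul, integral_const_mul,
    hlin_zero, integral_div, integral_const, probReal_univ, one_smul, mul_zero, sub_zero, hvar]

variable [TopologicalSpace G] {χ : G → ℂ} {Z : G → ℝ} {e : G}

theorem continuous_uncurry_centredRemainder (hχ : Continuous χ) (hZ : Continuous Z) :
    Continuous fun x : ℝ × G => centredRemainder χ Z x.1 x.2 := by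
  unfold centredRemainder
  fun_prop

theorem continuous_centredRemainder (hχ : Continuous χ) (hZ : Continuous Z) (m : ℝ) :
    Continuous (centredRemainder χ Z m) := by
  unfold centredRemainder
  fun_prop

theorem tendstoUniformly_centredRemainder [CompactSpace G] {α : Type*} {l : Filter α} {m : α → ℝ}
    {m₀ : ℝ} (hχ : Continuous χ) (hZ : Continuous Z) (hm : Tendsto m l (𝓝 m₀)) :
    TendstoUniformly (fun s => centredRemainder χ Z (m s)) (centredRemainder χ Z m₀) l :=
  ContinuousMap.tendsto_iff_tendstoUniformly.mp
    ((ContinuousMap.curry ⟨_, continuous_uncurry_centredRemainder hχ hZ⟩).continuous.tendsto m₀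
      |>.comp hm)

theorem isLittleO_exp_ofReal_mul_I :
    (fun t : ℝ => Complex.exp (Complex.I * t) - 1 - Complex.I * t + (t : ℂ) ^ 2 / 2) =o[𝓝 0]
      fun t => t ^ 2 := by
  have htendsto : Tendsto (fun t : ℝ => Complex.I * t) (𝓝 0) (𝓝 0) := by
    simpa using (by fun_prop : Continuous fun t : ℝ => Complex.I * t).tendsto 0
  refine ((Complex.exp_sub_sum_range_succ_isLittleO_pow 2).comp_tendsto htendsto).congr' ?_ ?_
    |>.trans_isBigO (Asymptotics.isBigO_of_le _ fun t => (?_ : ‖(Complex.I * t) ^ 2‖ ≤ _))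
  · filter_upwards with t
    simp only [Function.comp_apply, Finset.sum_range_succ, Finset.sum_range_zero]
    simp only [pow_zero, pow_one, Nat.factorial, mul_pow, Complex.I_sq]
    push_cast
    ring
  · exact .rfl
  · simp

theorem isLittleO_centredRemainder {α : Type*} {l : Filter α} {m : α → ℝ} (hZ : ContinuousAt Z e)
    (hχZ : ∀ᶠ y in 𝓝 e, χ y = Complex.exp (Complex.I * Z y)) (hm : Tendsto m l (𝓝 (Z e))) :
    (fun x : α × G => centredRemainder χ Z (m x.1) x.2) =o[l ×ˢ 𝓝 e]
      fun x => (Z x.2 - m x.1) ^ 2 := by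
  have hdiff : Tendsto (fun x : α × G => Z x.2 - m x.1) (l ×ˢ 𝓝 e) (𝓝 0) := by
    simpa using (hZ.tendsto.comp tendsto_snd).sub (hm.comp tendsto_fst)
  refine (isLittleO_exp_ofReal_mul_I.comp_tendsto hdiff).congr' ?_ .rfl
  filter_upwards [tendsto_snd.eventually hχZ] with x hx
  simp only [Function.comp_apply, centredRemainder, hx, Complex.ofReal_sub, ← Complex.exp_add]
  ring_nf

theorem isLittleO_centredRemainder_zero (hZ : ContinuousAt Z e) (hZe : Z e = 0)
    (hχZ : ∀ᶠ y in 𝓝 e, χ y = Complex.exp (Complex.I * Z y)) :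
    centredRemainder χ Z 0 =o[𝓝 e] fun y => Z y ^ 2 := by
  have huniform := isLittleO_centredRemainder (l := 𝓝 0) (m := id) hZ hχZ (hZe ▸ tendsto_id)
  simpa [Function.comp_def] using
    huniform.comp_tendsto ((tendsto_const_nhds (x := (0 : ℝ))).prodMk tendsto_id)

end CentredRemainder

section NullArrays

variable {G : Type*} [TopologicalSpace G] [CompactSpace G] [MeasurableSpace G] [BorelSpace G]
  {e : G}

theorem tendsto_integral_of_tendsto_diracProba {α 𝕜 : Type*} [RCLike 𝕜] {l : Filter α}
    {ν : α → ProbabilityMeasure G} (hν : Tendsto ν l (𝓝 (diracProba e))) {f : G → 𝕜}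
    (hf : Continuous f) : Tendsto (fun s => ∫ y, f y ∂(ν s : Measure G)) l (𝓝 (f e)) := by
  have h := (ProbabilityMeasure.tendsto_iff_forall_integral_rclike_tendsto 𝕜).mp hν
    (.mkOfCompact ⟨f, hf⟩)
  have hdirac : ∫ y, f y ∂Measure.dirac e = f e :=
    integral_dirac' _ _ (hf.stronglyMeasurable_of_hasCompactSupport (.of_compactSpace f))
  exact hdirac ▸ h

variable {ι : Type*} {κ : ι → Type*} [∀ n, Fintype (κ n)] {L : Filter ι}
  {ν : (Σ n, κ n) → ProbabilityMeasure G} {η : Measure G} {χ : G → ℂ} {Z : G → ℝ} {v : ℝ}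

theorem IsFiniteAwayFrom.integrable_sub_one_sub (hη : IsFiniteAwayFrom e η) (hχ : Continuous χ)
    (hZ : Continuous Z) (hZe : Z e = 0) (hχZ : ∀ᶠ y in 𝓝 e, χ y = Complex.exp (Complex.I * Z y))
    (hZη : Integrable (fun y => Z y ^ 2) η) :
    Integrable (fun y => χ y - 1 - Complex.I * Z y) η := by
  have hremainder : Integrable (centredRemainder χ Z 0) η :=
    hη.integrable_of_isBigO (continuous_centredRemainder hχ hZ 0)
      (isLittleO_centredRemainder_zero hZ.continuousAt hZe hχZ).isBigO hZη
  have hsq : Integrable (fun y => ((Z y ^ 2 : ℝ) : ℂ) / 2) η := hZη.ofReal.div_const 2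
  simpa [centredRemainder] using hremainder.sub' hsq

theorem IsFiniteAwayFrom.integral_centredRemainder (hη : IsFiniteAwayFrom e η) (hχ : Continuous χ)
    (hZ : Continuous Z) (hZe : Z e = 0) (hχZ : ∀ᶠ y in 𝓝 e, χ y = Complex.exp (Complex.I * Z y))
    (hZη : Integrable (fun y => Z y ^ 2) η) :
    ∫ y, centredRemainder χ Z 0 y ∂η =
      ∫ y, (χ y - 1 - Complex.I * Z y) ∂η + (∫ y, Z y ^ 2 ∂η : ℝ) / 2 := by
  have hsq : Integrable (fun y => ((Z y ^ 2 : ℝ) : ℂ) / 2) η := hZη.ofReal.div_const 2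
  rw [← integral_complex_ofReal, ← integral_div,
    ← integral_add (hη.integrable_sub_one_sub hχ hZ hZe hχZ hZη) hsq]
  simp [centredRemainder]

variable [T2Space G]

theorem TendstoAwayFrom.tendsto_sum_integral_centredRemainder {m : (Σ n, κ n) → ℝ}
    (hνη : TendstoAwayFrom L e (fun s => (ν s : Measure G)) η) (hη : IsFiniteAwayFrom e η)
    (hχ : Continuous χ) (hZ : Continuous Z) (hZe : Z e = 0)
    (hχZ : ∀ᶠ y in 𝓝 e, χ y = Complex.exp (Complex.I * Z y))
    (hZη : Integrable (fun y => Z y ^ 2) η) (hm : Tendsto m (rowFilter L κ) (𝓝 0))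
    (hbdd : IsBoundedUnder (· ≤ ·) L
      fun n => ∑ k, ∫ y, (Z y - m ⟨n, k⟩) ^ 2 ∂(ν ⟨n, k⟩ : Measure G)) :
    Tendsto (fun n => ∑ k, ∫ y, centredRemainder χ Z (m ⟨n, k⟩) y ∂(ν ⟨n, k⟩ : Measure G)) L
        (𝓝 (∫ y, centredRemainder χ Z 0 y ∂η)) ∧
      Tendsto (fun n => ∑ k, ∫ y, ‖centredRemainder χ Z (m ⟨n, k⟩) y‖ ∂(ν ⟨n, k⟩ : Measure G)) L
        (𝓝 (∫ y, ‖centredRemainder χ Z 0 y‖ ∂η)) := by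
  have hcont := continuous_centredRemainder hχ hZ
  have hunif := tendstoUniformly_centredRemainder hχ hZ hm
  have hlittleO := isLittleO_centredRemainder hZ.continuousAt hχZ (hZe.symm ▸ hm)
  have hlittleO_zero := isLittleO_centredRemainder_zero hZ.continuousAt hZe hχZ
  have hsq (s) : Integrable (fun y => (Z y - m s) ^ 2) (ν s : Measure G) :=
    integrable_of_continuous (by fun_prop)
  have hbdd_norm : IsBoundedUnder (· ≤ ·) L
      fun n => ∑ k, ∫ y, ‖(Z y - m ⟨n, k⟩) ^ 2‖ ∂(ν ⟨n, k⟩ : Measure G) := by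
    simpa only [norm_pow, Real.norm_eq_abs, sq_abs] using hbdd
  constructor
  · exact hνη.tendsto_sum_integral_of_isLittleO (F := fun s => centredRemainder χ Z (m s)) hη
      (fun s => hcont (m s)) (hcont 0) hunif hlittleO hlittleO_zero hsq hZη hbdd_norm
  · exact hνη.tendsto_sum_integral_of_isLittleO (F := fun s y => ‖centredRemainder χ Z (m s) y‖) hη
      (fun s => (hcont (m s)).norm) (hcont 0).norm
      (uniformContinuous_norm.comp_tendstoUniformly hunif) hlittleO.norm_left
      hlittleO_zero.norm_left hsq hZη hbdd_norm

theorem tendsto_prod_integral_of_tendsto_variance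
    (hν : Tendsto ν (rowFilter L κ) (𝓝 (diracProba e)))
    (hνη : TendstoAwayFrom L e (fun s => (ν s : Measure G)) η) (hη : IsFiniteAwayFrom e η)
    (hχ : Continuous χ) (hZ : Continuous Z) (hZe : Z e = 0)
    (hχZ : ∀ᶠ y in 𝓝 e, χ y = Complex.exp (Complex.I * Z y))
    (hZη : Integrable (fun y => Z y ^ 2) η)
    (hvar : Tendsto (fun n => ∑ k, Var[Z; (ν ⟨n, k⟩ : Measure G)]) L (𝓝 (v + ∫ y, Z y ^ 2 ∂η))) :
    Tendsto (fun n => ∏ k, Complex.exp (-(Complex.I * (∫ y, Z y ∂(ν ⟨n, k⟩ : Measure G) : ℝ))) *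
        ∫ y, χ y ∂(ν ⟨n, k⟩ : Measure G)) L
      (𝓝 (Complex.exp (-v / 2 + ∫ y, (χ y - 1 - Complex.I * Z y) ∂η))) := by
  set m : (Σ n, κ n) → ℝ := fun s => ∫ y, Z y ∂(ν s : Measure G)
  set z : (Σ n, κ n) → ℂ := fun s =>
    Complex.exp (-(Complex.I * (m s : ℝ))) * ∫ y, χ y ∂(ν s : Measure G)
  have hm : Tendsto m (rowFilter L κ) (𝓝 0) :=
    hZe ▸ tendsto_integral_of_tendsto_diracProba hν hZ
  have hz : Tendsto z (rowFilter L κ) (𝓝 1) := by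
    have h := ((by fun_prop : Continuous fun t : ℝ => Complex.exp (-(Complex.I * t))).tendsto 0
      |>.comp hm).mul (tendsto_integral_of_tendsto_diracProba hν hχ)
    simpa [hχZ.self_of_nhds, hZe] using h
  have hz_sub_one (s) : z s - 1 =
      ∫ y, centredRemainder χ Z (m s) y ∂(ν s : Measure G) - Var[Z; (ν s : Measure G)] / 2 := by
    rw [integral_centredRemainder (integrable_of_continuous hχ) (hZ.memLp_of_hasCompactSupport
      (.of_compactSpace Z)), add_sub_cancel_right]
  obtain ⟨hsum_remainder, hsum_norm⟩ := hνη.tendsto_sum_integral_centredRemainder hη hχ hZ hZe hχZ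
    hZη hm <| by simpa only [variance_eq_integral hZ.aemeasurable] using hvar.isBoundedUnder_le
  refine tendsto_prod_exp_of_tendsto_sum_sub_one hz ?_ ?_
  · refine (hsum_norm.add (hvar.div_const 2)).isBoundedUnder_le.mono_le (.of_forall fun n => ?_)
    beta_reduce
    rw [Finset.sum_div, ← Finset.sum_add_distrib]
    refine Finset.sum_le_sum fun k _ => ?_
    rw [hz_sub_one]
    refine (norm_sub_le _ _).trans (add_le_add (norm_integral_le_integral_norm _) ?_)
    simp [abs_of_nonneg (variance_nonneg _ _)]
  · have hsum := hsum_remainder.sub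
      ((Complex.continuous_ofReal.tendsto _ |>.comp hvar).div_const 2)
    rw [hη.integral_centredRemainder hχ hZ hZe hχZ hZη] at hsum
    convert hsum using 2 with n
    · simp [hz_sub_one, Finset.sum_sub_distrib, Finset.sum_div]
    · push_cast
      ring

end NullArrays

section TrigonometricPolynomials

variable {G : Type*} [CommGroup G] [TopologicalSpace G]

/-- The characters of `G` as bounded continuous complex functions. -/
noncomputable def charBCF : PontryaginDual G →* (G →ᵇ ℂ) where
  toFun χ := .ofNormedAddCommGroup (fun x => (χ x : ℂ))
    (continuous_subtype_val.comp (map_continuous χ)) 1 fun x => (Circle.norm_coe (χ x)).le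
  map_one' := by ext; exact Circle.coe_one
  map_mul' χ ψ := by ext x; exact Circle.coe_mul (χ x) (ψ x)

theorem star_charBCF (χ : PontryaginDual G) : star (charBCF χ) = charBCF χ⁻¹ := by
  ext x
  exact (Circle.coe_inv_eq_conj (χ x)).symm

/-- The trigonometric polynomials on `G`: the star algebra generated by the characters. -/
noncomputable def trigPoly (G : Type*) [CommGroup G] [TopologicalSpace G] :
    StarSubalgebra ℂ (G →ᵇ ℂ) :=
  StarAlgebra.adjoin ℂ (Set.range charBCF)

theorem mem_trigPoly_iff_mem_span {f : G →ᵇ ℂ} :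
    f ∈ trigPoly G ↔ f ∈ Submodule.span ℂ (Set.range (charBCF (G := G))) := by
  have hstar : star (Set.range (charBCF (G := G))) ⊆ Set.range charBCF := by
    rintro f ⟨χ, hχ⟩
    exact ⟨χ⁻¹, by rw [← star_charBCF, hχ, star_star]⟩
  rw [← StarSubalgebra.mem_toSubalgebra, ← Subalgebra.mem_toSubmodule, trigPoly,
    StarAlgebra.adjoin_toSubalgebra, Set.union_eq_self_of_subset_right hstar,
    Algebra.adjoin_eq_span, ← MonoidHom.coe_mrange, Submonoid.closure_eq]

theorem separatesPoints_trigPoly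
    (hsep : Function.Injective fun (x : G) (χ : PontryaginDual G) => χ x) :
    ((trigPoly G).map (BoundedContinuousFunction.toContinuousMapStarₐ ℂ)).SeparatesPoints := by
  intro x y hxy
  obtain ⟨χ, hχ⟩ := Function.ne_iff.mp (hsep.ne hxy)
  refine ⟨charBCF χ, ⟨_, ⟨charBCF χ, StarAlgebra.subset_adjoin ℂ _ ⟨χ, rfl⟩, rfl⟩, rfl⟩, ?_⟩
  exact Circle.coe_injective.ne hχ

end TrigonometricPolynomials

section FourierTransform

variable {G : Type*} [CommGroup G] [TopologicalSpace G] [MeasurableSpace G]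

theorem integrable_char [OpensMeasurableSpace G] (μ : Measure G) [IsFiniteMeasure μ]
    (χ : PontryaginDual G) : Integrable (fun x => (χ x : ℂ)) μ :=
  (charBCF χ).integrable μ

theorem fourierTransform_dirac [OpensMeasurableSpace G] (a : G) (χ : PontryaginDual G) :
    fourierTransform (Measure.dirac a) χ = χ a :=
  integral_dirac' _ _ (charBCF χ).continuous.stronglyMeasurable

theorem fourierTransform_map [OpensMeasurableSpace G] {Ω : Type*} [MeasurableSpace Ω]
    {P : Measure Ω} {X : Ω → G} (hX : AEMeasurable X P) (χ : PontryaginDual G) :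
    fourierTransform (P.map X) χ = ∫ ω, (χ (X ω) : ℂ) ∂P :=
  integral_map hX (charBCF χ).continuous.aestronglyMeasurable

theorem fourierTransform_mconv [OpensMeasurableSpace G] [MeasurableMul₂ G] (μ ν : Measure G)
    [IsFiniteMeasure μ] [IsFiniteMeasure ν] (χ : PontryaginDual G) :
    fourierTransform (μ ∗ₘ ν) χ = fourierTransform μ χ * fourierTransform ν χ := by
  rw [fourierTransform, integral_mconv (integrable_char _ χ)]
  simp only [map_mul, Circle.coe_mul, integral_const_mul, integral_mul_const]
  rfl

theorem fourierTransform_map_prod [BorelSpace G] [MeasurableMul₂ G] {Ω : Type*}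
    [MeasurableSpace Ω] {P : Measure Ω} {κ : Type*} [Fintype κ] {X : κ → Ω → G}
    (hX : ∀ k, Measurable (X k)) (hindep : iIndepFun X P) (χ : PontryaginDual G) :
    fourierTransform (P.map fun ω => ∏ k, X k ω) χ = ∏ k, fourierTransform (P.map (X k)) χ := by
  rw [fourierTransform_map (Finset.measurable_fun_prod _ fun k _ => hX k).aemeasurable]
  simp only [fourierTransform_map (hX _).aemeasurable]
  rw [← hindep.integral_fun_prod_comp (f := fun _ x => (χ x : ℂ)) (fun k => (hX k).aemeasurable)
    fun k => (charBCF χ).continuous.aestronglyMeasurable]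
  congr with ω
  rw [map_prod]
  exact map_prod Circle.coeHom _ _

theorem continuous_fourierTransform [OpensMeasurableSpace G] :
    Continuous fun μ : ProbabilityMeasure G => fourierTransform (μ : Measure G) :=
  continuous_pi fun χ => continuous_iff_continuousAt.mpr fun _ =>
    (ProbabilityMeasure.tendsto_iff_forall_integral_rclike_tendsto ℂ).mp tendsto_id (charBCF χ)

variable [BorelSpace G]

theorem injective_fourierTransform [PolishSpace G]
    (hsep : Function.Injective fun (x : G) (χ : PontryaginDual G) => χ x) :
    Function.Injective fun μ : ProbabilityMeasure G => fourierTransform (μ : Measure G) := by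
  intro μ ν hμν
  refine Subtype.ext (ext_of_forall_mem_subalgebra_integral_eq_of_polish
    (P := (μ : Measure G)) (P' := (ν : Measure G)) (separatesPoints_trigPoly hsep) fun f hf => ?_)
  rw [mem_trigPoly_iff_mem_span] at hf
  induction hf using Submodule.span_induction with
  | mem f hf =>
    obtain ⟨χ, rfl⟩ := hf
    exact congrFun hμν χ
  | zero => simp
  | add f g _ _ hf hg =>
    simp only [BoundedContinuousFunction.coe_add, Pi.add_apply]
    rw [integral_add (f.integrable _) (g.integrable _), hf, hg,
      integral_add (f.integrable _) (g.integrable _)]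
  | smul c f _ hf => simp only [BoundedContinuousFunction.coe_smul, integral_smul, hf]

variable [CompactSpace G] [PolishSpace G]

theorem isClosedEmbedding_fourierTransform
    (hsep : Function.Injective fun (x : G) (χ : PontryaginDual G) => χ x) :
    IsClosedEmbedding fun μ : ProbabilityMeasure G => fourierTransform (μ : Measure G) :=
  continuous_fourierTransform.isClosedEmbedding (injective_fourierTransform hsep)

theorem tendsto_iff_tendsto_fourierTransform
    (hsep : Function.Injective fun (x : G) (χ : PontryaginDual G) => χ x) {α : Type*}
    {l : Filter α} {μ : α → ProbabilityMeasure G} {μ₀ : ProbabilityMeasure G} :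
    Tendsto μ l (𝓝 μ₀) ↔ ∀ χ, Tendsto (fun s => fourierTransform (μ s : Measure G) χ) l
      (𝓝 (fourierTransform (μ₀ : Measure G) χ)) :=
  (isClosedEmbedding_fourierTransform hsep).tendsto_nhds_iff.trans tendsto_pi_nhds

end FourierTransform

section CompoundPoisson

/-- The Fourier transforms of the probability measures on `G`, a monoid because convolution of
measures becomes multiplication. -/
noncomputable def fourierTransforms (G : Type*) [CommGroup G] [TopologicalSpace G]
    [MeasurableSpace G] [OpensMeasurableSpace G] [MeasurableMul₂ G] :
    Submonoid (PontryaginDual G → ℂ) where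
  carrier := Set.range fun μ : ProbabilityMeasure G => fourierTransform (μ : Measure G)
  one_mem' := ⟨diracProba 1, funext fun χ => by
    simp [diracProba, fourierTransform_dirac]⟩
  mul_mem' := by
    rintro _ _ ⟨μ, rfl⟩ ⟨ν, rfl⟩
    exact ⟨⟨(μ : Measure G) ∗ₘ (ν : Measure G), inferInstance⟩,
      funext fun χ => fourierTransform_mconv _ _ χ⟩

variable {G : Type*} [CommGroup G] [TopologicalSpace G] [MeasurableSpace G] [BorelSpace G]
  [MeasurableMul₂ G]

theorem char_apply_mem_fourierTransforms (a : G) :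
    (fun χ : PontryaginDual G => (χ a : ℂ)) ∈ fourierTransforms G :=
  ⟨diracProba a, funext (fourierTransform_dirac a)⟩

theorem one_add_integral_char_sub_one_mem_fourierTransforms (ν : Measure G)
    (hν : ν Set.univ ≤ 1) :
    (fun χ : PontryaginDual G => 1 + ∫ x, ((χ x : ℂ) - 1) ∂ν) ∈ fourierTransforms G := by
  have : IsFiniteMeasure ν := ⟨hν.trans_lt ENNReal.one_lt_top⟩
  refine ⟨⟨(1 - ν Set.univ) • Measure.dirac 1 + ν, ⟨by simp [tsub_add_cancel_of_le hν]⟩⟩,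
    funext fun χ => ?_⟩
  have hχ := integrable_char ν χ
  simp only [ProbabilityMeasure.coe_mk]
  rw [fourierTransform, integral_add_measure ((integrable_char _ χ).smul_measure (by simp)) hχ,
    integral_smul_measure, ← fourierTransform, fourierTransform_dirac,
    integral_sub hχ (integrable_const _), ENNReal.toReal_sub_of_le hν ENNReal.one_ne_top]
  simp [measureReal_def]
  ring

variable [CompactSpace G] [PolishSpace G]

theorem isClosed_fourierTransforms :
    IsClosed (fourierTransforms G : Set (PontryaginDual G → ℂ)) :=
  (isCompact_range continuous_fourierTransform).isClosed

theorem exp_integral_char_sub_one_mem_fourierTransforms (ν : Measure G) [IsFiniteMeasure ν] :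
    (fun χ : PontryaginDual G => Complex.exp (∫ x, ((χ x : ℂ) - 1) ∂ν)) ∈
      fourierTransforms G := by
  refine isClosed_fourierTransforms.mem_of_tendsto (b := atTop) (tendsto_pi_nhds.mpr fun χ =>
    Complex.tendsto_one_add_div_pow_exp (∫ x, ((χ x : ℂ) - 1) ∂ν)) ?_
  obtain ⟨N, hN⟩ := ENNReal.exists_nat_gt (measure_ne_top ν Set.univ)
  filter_upwards [eventually_ge_atTop N] with n hn
  have hmass : ((n : ENNReal)⁻¹ • ν) Set.univ ≤ 1 := by
    rw [Measure.smul_apply, smul_eq_mul, mul_comm, ← div_eq_mul_inv]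
    exact ENNReal.div_le_of_le_mul (by simpa using hN.le.trans (by exact_mod_cast hn))
  have hpow := pow_mem (one_add_integral_char_sub_one_mem_fourierTransforms _ hmass) n
  refine Set.mem_of_eq_of_mem (funext fun χ => ?_) hpow
  simp [div_eq_inv_mul]

end CompoundPoisson

section LevyMeasure

variable {G : Type*} [CommGroup G] [TopologicalSpace G] [MeasurableSpace G] {η : Measure G}

theorem IsLevyMeasure.isFiniteAwayFrom [OpensMeasurableSpace G] (hη : IsLevyMeasure η) :
    IsFiniteAwayFrom 1 η := fun _ hU =>
  (measure_mono (Set.compl_subset_compl.mpr interior_subset)).trans_lt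
    (hη.measure_compl_lt_top _ isOpen_interior.measurableSet (interior_mem_nhds.mpr hU))

theorem IsLevyMeasure.integrable_one_sub_re [OpensMeasurableSpace G] (hη : IsLevyMeasure η)
    (χ : PontryaginDual G) : Integrable (fun y => 1 - (χ y : ℂ).re) η := by
  have hcont : Continuous fun y => 1 - (charBCF χ y).re := by fun_prop
  refine ⟨hcont.aestronglyMeasurable, (hasFiniteIntegral_iff_ofReal (.of_forall fun y => ?_)).mpr
    (hη.lintegral_lt_top χ)⟩
  exact sub_nonneg.mpr ((Complex.re_le_norm _).trans (Circle.norm_coe _).le)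

/-- The properties of a local inner product on `G` used here: `g (·, χ)` is real-valued,
continuous, vanishes at the neutral element and is a logarithm of the character `χ`, divided
by `i`, near the neutral element. -/
structure IsLocalLogarithm (g : G → PontryaginDual G → ℝ) : Prop where
  continuous (χ : PontryaginDual G) : Continuous fun y => g y χ
  apply_one (χ : PontryaginDual G) : g 1 χ = 0
  char_eq_exp (χ : PontryaginDual G) : ∀ᶠ y in 𝓝 1, (χ y : ℂ) = Complex.exp (Complex.I * g y χ)

namespace IsLocalLogarithm

variable {g : G → PontryaginDual G → ℝ}

omit [MeasurableSpace G] in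
theorem isBigO_sq (hg : IsLocalLogarithm g) (χ : PontryaginDual G) :
    (fun y => g y χ ^ 2) =O[𝓝 1] fun y => 1 - (χ y : ℂ).re := by
  have hsmall : ∀ᶠ y in 𝓝 1, |g y χ| < Real.pi :=
    (hg.continuous χ).abs.continuousAt.eventually_lt continuousAt_const
      (by simp [hg.apply_one, Real.pi_pos])
  refine .of_bound (Real.pi ^ 2 / 2) ?_
  filter_upwards [hsmall, hg.char_eq_exp χ] with y hy hχy
  have hre : (χ y : ℂ).re = Real.cos (g y χ) := by
    rw [hχy, mul_comm, Complex.exp_ofReal_mul_I_re]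
  have hcos := Real.cos_le_one_sub_mul_cos_sq hy.le
  rw [hre, Real.norm_of_nonneg (sq_nonneg _),
    Real.norm_of_nonneg (sub_nonneg.mpr (Real.cos_le_one _))]
  calc g y χ ^ 2 = Real.pi ^ 2 / 2 * (2 / Real.pi ^ 2 * g y χ ^ 2) := by field_simp
    _ ≤ Real.pi ^ 2 / 2 * (1 - Real.cos (g y χ)) := by gcongr; linarith

variable [CompactSpace G] [BorelSpace G]

theorem integrable_sq (hg : IsLocalLogarithm g) (hη : IsLevyMeasure η) (χ : PontryaginDual G) :
    Integrable (fun y => g y χ ^ 2) η :=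
  hη.isFiniteAwayFrom.integrable_of_isBigO ((hg.continuous χ).pow 2) (hg.isBigO_sq χ)
    (hη.integrable_one_sub_re χ)

theorem integrable_char_sub_one_sub (hg : IsLocalLogarithm g) (hη : IsLevyMeasure η)
    (χ : PontryaginDual G) :
    Integrable (fun y => (χ y : ℂ) - 1 - Complex.I * g y χ) η :=
  hη.isFiniteAwayFrom.integrable_sub_one_sub (charBCF χ).continuous (hg.continuous χ)
    (hg.apply_one χ) (hg.char_eq_exp χ) (hg.integrable_sq hη χ)

variable [PolishSpace G] [MeasurableMul₂ G]

theorem exp_integral_mem_fourierTransforms_of_isFiniteMeasure (hg : IsLocalLogarithm g)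
    {ν : Measure G} [IsFiniteMeasure ν] {x : G}
    (hx : ∀ χ : PontryaginDual G, (χ x : ℂ) = Complex.exp (Complex.I * (∫ y, g y χ ∂ν : ℝ))) :
    (fun χ : PontryaginDual G => Complex.exp (∫ y, ((χ y : ℂ) - 1 - Complex.I * g y χ) ∂ν)) ∈
      fourierTransforms G := by
  refine Set.mem_of_eq_of_mem (funext fun χ => ?_)
    (mul_mem (exp_integral_char_sub_one_mem_fourierTransforms ν)
      (char_apply_mem_fourierTransforms x⁻¹))
  have hg_int : Integrable (fun y => Complex.I * (g y χ : ℂ)) ν :=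
    ((integrable_of_continuous (hg.continuous χ)).ofReal).const_mul _
  rw [integral_sub ((integrable_char ν χ).sub' (integrable_const 1)) hg_int, integral_const_mul,
    integral_complex_ofReal, Complex.exp_sub, ← hx, div_eq_mul_inv, Pi.mul_apply, map_inv,
    Circle.coe_inv]

theorem exists_isGeneralizedPoisson (hg : IsLocalLogarithm g) (hη : IsLevyMeasure η)
    (hmean : ∀ ν : Measure G, IsFiniteMeasure ν → ∃ x : G, ∀ χ : PontryaginDual G,
      (χ x : ℂ) = Complex.exp (Complex.I * (∫ y, g y χ ∂ν : ℝ))) :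
    ∃ π : ProbabilityMeasure G, IsGeneralizedPoisson η g π := by
  obtain ⟨U, hU, hbasis⟩ := (nhds_basis_opens (1 : G)).exists_antitone_subbasis
  have hcover : AECover η atTop fun n => (U n)ᶜ := by
    refine ⟨?_, fun n => (hU n).2.measurableSet.compl⟩
    filter_upwards [measure_eq_zero_iff_ae_notMem.mp hη.measure_one] with y hy
    exact (hbasis.eventually_subset (isOpen_compl_singleton.mem_nhds (Ne.symm hy))).mono
      fun n hn hyn => hn hyn rfl
  have hlim : Tendsto (fun n (χ : PontryaginDual G) =>
      Complex.exp (∫ y in (U n)ᶜ, ((χ y : ℂ) - 1 - Complex.I * g y χ) ∂η)) atTop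
      (𝓝 fun χ => Complex.exp (∫ y, ((χ y : ℂ) - 1 - Complex.I * g y χ) ∂η)) :=
    tendsto_pi_nhds.mpr fun χ => (Complex.continuous_exp.tendsto _).comp
      (hcover.integral_tendsto_of_countably_generated (hg.integrable_char_sub_one_sub hη χ))
  obtain ⟨π, hπ⟩ := isClosed_fourierTransforms.mem_of_tendsto hlim <| .of_forall fun n => by
    have : IsFiniteMeasure (η.restrict (U n)ᶜ) :=
      ⟨by simpa using hη.isFiniteAwayFrom _ (hbasis.mem n)⟩
    obtain ⟨x, hx⟩ := hmean (η.restrict (U n)ᶜ) this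
    exact hg.exp_integral_mem_fourierTransforms_of_isFiniteMeasure hx
  exact ⟨π, congrFun hπ⟩

end IsLocalLogarithm

end LevyMeasure

section Uniqueness

variable {G : Type*} [CommGroup G] [TopologicalSpace G] [MeasurableSpace G] [BorelSpace G]
  [PolishSpace G]

theorem IsGaussMeasure.unique {ψ : PontryaginDual G → ℝ} {γ γ' : ProbabilityMeasure G}
    (hsep : Function.Injective fun (x : G) (χ : PontryaginDual G) => χ x)
    (hγ : IsGaussMeasure ψ γ) (hγ' : IsGaussMeasure ψ γ') : γ = γ' :=
  injective_fourierTransform hsep (funext fun χ => (hγ χ).trans (hγ' χ).symm)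

theorem IsGeneralizedPoisson.unique {η : Measure G} {g : G → PontryaginDual G → ℝ}
    {π π' : ProbabilityMeasure G}
    (hsep : Function.Injective fun (x : G) (χ : PontryaginDual G) => χ x)
    (hπ : IsGeneralizedPoisson η g π) (hπ' : IsGeneralizedPoisson η g π') : π = π' :=
  injective_fourierTransform hsep (funext fun χ => (hπ χ).trans (hπ' χ).symm)

end Uniqueness

section TriangularArrays

variable {G : Type*} [TopologicalSpace G] [MeasurableSpace G]

theorem tendsto_diracProba_of_tendsto_measure_compl [OpensMeasurableSpace G] {α : Type*}
    {l : Filter α} [l.IsCountablyGenerated] {ν : α → ProbabilityMeasure G} {e : G}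
    (h : ∀ U : Set G, IsOpen U → e ∈ U → Tendsto (fun s => (ν s : Measure G) Uᶜ) l (𝓝 0)) :
    Tendsto ν l (𝓝 (diracProba e)) := by
  rcases l.eq_or_neBot with rfl | _
  · exact tendsto_bot
  refine tendsto_of_forall_isOpen_le_liminf' fun U hU => ?_
  by_cases he : e ∈ U
  · have hlim : Tendsto (fun s => (ν s : Measure G) U) l (𝓝 1) := by
      have hsub := ENNReal.Tendsto.sub (tendsto_const_nhds (x := (1 : ENNReal))) (h U hU he)
        (.inl ENNReal.one_ne_top)
      rw [tsub_zero] at hsub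
      refine hsub.congr fun s => ?_
      rw [← prob_compl_eq_one_sub hU.measurableSet.compl, compl_compl]
    exact prob_le_one.trans hlim.liminf_eq.ge
  · simp [diracProba, hU.measurableSet, he]

variable {Ω : ℕ → Type*} [∀ n, MeasurableSpace (Ω n)] (P : ∀ n, Measure (Ω n))
  [∀ n, IsProbabilityMeasure (P n)] {K : ℕ → ℕ} (X : ∀ n, Fin (K n) → Ω n → G)

/-- The laws of the entries of a triangular array of random elements, on the index set of
the array. -/
noncomputable def entryLaw (hX : ∀ n k, Measurable (X n k)) (s : Σ n, Fin (K n)) :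
    ProbabilityMeasure G :=
  ⟨(P s.1).map (X s.1 s.2), Measure.isProbabilityMeasure_map (hX s.1 s.2).aemeasurable⟩

variable {P X}

omit [TopologicalSpace G] in
theorem coe_entryLaw (hX : ∀ n k, Measurable (X n k)) (s : Σ n, Fin (K n)) :
    (entryLaw P X hX s : Measure G) = (P s.1).map (X s.1 s.2) := rfl

theorem tendstoAwayFrom_entryLaw [BorelSpace G] [CompactSpace G] {e : G} {η : Measure G}
    (hX : ∀ n k, Measurable (X n k))
    (h : ∀ f : G →ᵇ ℝ, (∃ U ∈ 𝓝 e, ∀ y ∈ U, f y = 0) →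
      Tendsto (fun n => ∑ k, ∫ ω, f (X n k ω) ∂P n) atTop (𝓝 (∫ y, f y ∂η))) :
    TendstoAwayFrom atTop e (fun s => (entryLaw P X hX s : Measure G)) η := by
  intro f hf
  refine (h (.mkOfCompact f) ⟨_, hf, fun y hy => hy⟩).congr fun n => ?_
  simp only [coe_entryLaw, BoundedContinuousFunction.mkOfCompact_apply]
  exact Finset.sum_congr rfl fun k _ =>
    (integral_map (hX n k).aemeasurable
      (BoundedContinuousFunction.mkOfCompact f).continuous.aestronglyMeasurable).symm

end TriangularArrays

section GaussPoisson

variable {G : Type*} [CommGroup G] [TopologicalSpace G] [MeasurableSpace G] [BorelSpace G]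
  {Ω : ℕ → Type*} [∀ n, MeasurableSpace (Ω n)] {P : ∀ n, Measure (Ω n)}
  [∀ n, IsProbabilityMeasure (P n)] {K : ℕ → ℕ} {X : ∀ n, Fin (K n) → Ω n → G}

theorem IsInfinitesimalArray.tendsto_entryLaw (hX : ∀ n k, Measurable (X n k))
    (h : IsInfinitesimalArray P K X) :
    Tendsto (entryLaw P X hX) (rowFilter atTop fun n => Fin (K n)) (𝓝 (diracProba 1)) := by
  have : (rowFilter atTop fun n => Fin (K n)).IsCountablyGenerated :=
    comap.isCountablyGenerated _ _
  refine tendsto_diracProba_of_tendsto_measure_compl fun U hU h1 => ?_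
  refine tendsto_of_tendsto_of_tendsto_of_le_of_le tendsto_const_nhds
    ((h U hU.measurableSet (hU.mem_nhds h1)).comp tendsto_comap) (fun _ => zero_le) ?_
  rintro ⟨n, k⟩
  beta_reduce
  rw [coe_entryLaw, Measure.map_apply (hX n k) hU.measurableSet.compl]
  exact le_iSup (fun k => P n {ω | X n k ω ∉ U}) k

variable [CompactSpace G] {g : G → PontryaginDual G → ℝ} {η : Measure G}
  {ψ : PontryaginDual G → ℝ} {a : G}

theorem IsInfinitesimalArray.tendsto_prod_fourierTransform [T2Space G]
    (h : IsInfinitesimalArray P K X) (hX : ∀ n k, Measurable (X n k))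
    (hg : IsLocalLogarithm g) (hη : IsLevyMeasure η) (χ : PontryaginDual G)
    (hmean : Tendsto (fun n => Complex.exp (Complex.I * (∑ k, ∫ ω, g (X n k ω) χ ∂P n : ℝ))) atTop
      (𝓝 (χ a)))
    (hvar : Tendsto (fun n => ∑ k, Var[fun ω => g (X n k ω) χ; P n]) atTop
      (𝓝 (ψ χ + ∫ y, g y χ ^ 2 ∂η)))
    (hνη : TendstoAwayFrom atTop 1 (fun s => (entryLaw P X hX s : Measure G)) η) :
    Tendsto (fun n => ∏ k, fourierTransform ((P n).map (X n k)) χ) atTop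
      (𝓝 (χ a * Complex.exp (-ψ χ / 2 + ∫ y, ((χ y : ℂ) - 1 - Complex.I * g y χ) ∂η))) := by
  have hgχ := hg.continuous χ
  have hvar_map (n) (k : Fin (K n)) :
      Var[fun y => g y χ; (P n).map (X n k)] = Var[fun ω => g (X n k ω) χ; P n] :=
    variance_map hgχ.aemeasurable (hX n k).aemeasurable
  have hmean_map (n) (k : Fin (K n)) :
      ∫ y, g y χ ∂(P n).map (X n k) = ∫ ω, g (X n k ω) χ ∂P n :=
    integral_map (hX n k).aemeasurable hgχ.aestronglyMeasurable
  have hcentred := tendsto_prod_integral_of_tendsto_variance (v := ψ χ) (h.tendsto_entryLaw hX) hνη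
    hη.isFiniteAwayFrom (charBCF χ).continuous hgχ (hg.apply_one χ) (hg.char_eq_exp χ)
    (hg.integrable_sq hη χ) (by simpa only [coe_entryLaw, hvar_map] using hvar)
  refine (hmean.mul hcentred).congr fun n => ?_
  simp only [coe_entryLaw, hmean_map]
  rw [Finset.prod_mul_distrib, ← Complex.exp_sum, ← mul_assoc, ← Complex.exp_add,
    Finset.sum_neg_distrib, ← Finset.mul_sum, Complex.ofReal_sum, add_neg_cancel,
    Complex.exp_zero, one_mul]
  rfl

theorem IsInfinitesimalArray.tendstoInDistribution_prod [PolishSpace G] [MeasurableMul₂ G]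
    (h : IsInfinitesimalArray P K X)
    (hsep : Function.Injective fun (x : G) (χ : PontryaginDual G) => χ x)
    (hX : ∀ n k, Measurable (X n k)) (hindep : ∀ n, iIndepFun (X n) (P n))
    (hg : IsLocalLogarithm g) (hη : IsLevyMeasure η)
    (hmean : ∀ χ : PontryaginDual G, Tendsto (fun n =>
      Complex.exp (Complex.I * (∑ k, ∫ ω, g (X n k ω) χ ∂P n : ℝ))) atTop (𝓝 (χ a)))
    (hvar : ∀ χ, Tendsto (fun n => ∑ k, Var[fun ω => g (X n k ω) χ; P n]) atTop
      (𝓝 (ψ χ + ∫ y, g y χ ^ 2 ∂η)))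
    (hνη : TendstoAwayFrom atTop 1 (fun s => (entryLaw P X hX s : Measure G)) η)
    {γ π : ProbabilityMeasure G} (hγ : IsGaussMeasure ψ γ) (hπ : IsGeneralizedPoisson η g π) :
    TendstoInDistribution (fun n ω => ∏ k, X n k ω) atTop id P
      (Measure.dirac a ∗ₘ (γ : Measure G) ∗ₘ (π : Measure G)) where
  forall_aemeasurable n := (Finset.measurable_fun_prod _ fun k _ => hX n k).aemeasurable
  tendsto := (tendsto_iff_tendsto_fourierTransform hsep).mpr fun χ => by
    simp only [ProbabilityMeasure.coe_mk, Measure.map_id, fourierTransform_map_prod (hX _)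
      (hindep _), fourierTransform_mconv, fourierTransform_dirac, hγ χ, hπ χ]
    rw [← Complex.exp_add]
    exact h.tendsto_prod_fourierTransform hX hg hη χ (hmean χ) (hvar χ) hνη

end GaussPoisson

section Truncation

theorem circleArg_mem_Ico (z : Circle) : circleArg z ∈ Set.Ico (-Real.pi) Real.pi := by
  rw [circleArg]
  split_ifs with h
  · exact ⟨le_rfl, by linarith [Real.pi_pos]⟩
  · exact ⟨(Complex.neg_pi_lt_arg _).le, lt_of_le_of_ne (Complex.arg_le_pi _) h⟩

theorem exp_circleArg (z : Circle) : Circle.exp (circleArg z) = z := by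
  rw [circleArg]
  split_ifs with h
  · rw [← Circle.exp_arg z, h, Circle.exp_eq_exp]
    exact ⟨-1, by push_cast; ring⟩
  · exact Circle.exp_arg z

theorem circleExp_im (x : ℝ) : (Circle.exp x : ℂ).im = Real.sin x := by
  rw [Circle.coe_exp, Complex.exp_ofReal_mul_I_im]

theorem truncH_eq_arcsin_sin {x : ℝ} (hx : x ∈ Set.Ico (-Real.pi) Real.pi) :
    truncH x = Real.arcsin (Real.sin x) := by
  obtain ⟨hx_ge, hx_lt⟩ := hx
  rw [truncH, if_neg (by rintro (h | h) <;> linarith)]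
  split_ifs with hleft hmiddle
  · rw [← Real.arcsin_sin (x := -x - Real.pi) (by linarith) (by linarith), Real.sin_sub_pi,
      Real.sin_neg, neg_neg]
  · rw [Real.arcsin_sin (by linarith) (by linarith)]
  · rw [← Real.arcsin_sin (x := -x + Real.pi) (by linarith) (by linarith), Real.sin_add_pi,
      Real.sin_neg, neg_neg]

theorem truncH_circleArg (z : Circle) : truncH (circleArg z) = Real.arcsin (z : ℂ).im := by
  rw [truncH_eq_arcsin_sin (circleArg_mem_Ico z), ← circleExp_im, exp_circleArg]

theorem continuous_truncH_circleArg : Continuous fun z => truncH (circleArg z) := by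
  simp only [truncH_circleArg]
  exact Real.continuous_arcsin.comp (Complex.continuous_im.comp continuous_subtype_val)

theorem truncH_circleArg_exp {x : ℝ} (hx : |x| ≤ Real.pi / 2) :
    truncH (circleArg (Circle.exp x)) = x := by
  obtain ⟨hx_ge, hx_le⟩ := abs_le.mp hx
  rw [truncH_circleArg, circleExp_im, Real.arcsin_sin hx_ge hx_le]

end Truncation

section Solenoid

variable (p : ℕ)

theorem isClosed_solenoid : IsClosed (solenoid p : Set (ℕ → Circle)) := by
  have hInter : (solenoid p : Set (ℕ → Circle)) = ⋂ j, {y | y j = y (j + 1) ^ p} := by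
    ext y
    simp only [Set.mem_iInter]
    rfl
  rw [hInter]
  exact isClosed_iInter fun j => isClosed_eq (continuous_apply j) ((continuous_apply _).pow p)

instance instCompactSpaceSolenoid : CompactSpace (solenoid p) :=
  isCompact_iff_compactSpace.mp (isClosed_solenoid p).isCompact

instance instPolishSpaceSolenoid : PolishSpace (solenoid p) := by
  have : PolishSpace Circle := (Metric.isClosed_sphere (x := (0 : ℂ)) (ε := 1)).polishSpace
  exact (isClosed_solenoid p).polishSpace

theorem continuous_solenoid_apply (d : ℕ) :
    Continuous fun y : solenoid p => (y : ℕ → Circle) d :=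
  (continuous_apply d).comp continuous_subtype_val

theorem injective_char_solenoid :
    Function.Injective fun (x : solenoid p) (χ : PontryaginDual (solenoid p)) => χ x := by
  intro x y hxy
  exact Subtype.ext (funext fun d => by simpa using congrFun hxy (solenoidChar p d 1))

variable {p}

theorem solenoid_apply_zero_eq_pow (y : solenoid p) (d : ℕ) :
    (y : ℕ → Circle) 0 = (y : ℕ → Circle) d ^ p ^ d := by
  induction d with
  | zero => simp
  | succ d ih => rw [ih, y.2 d, ← pow_mul, pow_succ, mul_comm]

theorem exists_forall_abs_circleArg_le_imp_mem {U : Set (solenoid p)} (hU : U ∈ 𝓝 1) :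
    ∃ (d : ℕ) (ε : ℝ), 0 < ε ∧
      ∀ y : solenoid p, (∀ j ≤ d, |circleArg ((y : ℕ → Circle) j)| ≤ ε) → y ∈ U := by
  rw [nhds_subtype_eq_comap, Filter.mem_comap] at hU
  obtain ⟨W, hW, hWU⟩ := hU
  rw [nhds_pi, Filter.mem_pi] at hW
  obtain ⟨I, hI, t, ht, htW⟩ := hW
  obtain ⟨d, hd⟩ := hI.bddAbove
  have hsmall : ∀ᶠ ε : ℝ in 𝓝[>] 0, ∀ j ∈ I, ∀ z : Circle, |circleArg z| ≤ ε → z ∈ t j := by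
    refine (Filter.eventually_all_finite hI).mpr fun j _ => ?_
    have hpre : Circle.exp ⁻¹' t j ∈ 𝓝 (0 : ℝ) :=
      Circle.exp.continuous.continuousAt.preimage_mem_nhds (by simpa using ht j)
    obtain ⟨δ, hδ, hδt⟩ := Metric.mem_nhds_iff.mp hpre
    filter_upwards [Ioo_mem_nhdsGT hδ] with ε hε z hz
    rw [← exp_circleArg z]
    exact hδt (by simpa using hz.trans_lt hε.2)
  obtain ⟨ε, hε, hε0⟩ := (hsmall.and self_mem_nhdsWithin).exists
  exact ⟨d, ε, hε0, fun y hy => hWU (htW fun j hj => hε j hj _ (hy j (hd hj)))⟩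

theorem isInfinitesimalArray_of_tendsto_circleArg {Ω : ℕ → Type*} [∀ n, MeasurableSpace (Ω n)]
    {P : ∀ n, Measure (Ω n)} {K : ℕ → ℕ} {X : ∀ n, Fin (K n) → Ω n → solenoid p}
    (h : ∀ (d : ℕ) (ε : ℝ), 0 < ε →
      Tendsto (fun n => ⨆ k : Fin (K n),
        P n {ω | ∃ j ≤ d, ε < |circleArg ((X n k ω : ℕ → Circle) j)|}) atTop (𝓝 0)) :
    IsInfinitesimalArray P K X := by
  intro U _ hU
  obtain ⟨d, ε, hε, hsub⟩ := exists_forall_abs_circleArg_le_imp_mem hU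
  refine tendsto_of_tendsto_of_tendsto_of_le_of_le tendsto_const_nhds (h d ε hε)
    (fun n => zero_le) fun n => iSup_mono fun k => measure_mono fun ω hω => ?_
  by_contra! hsmall
  simp only [Set.mem_ofPred_eq, not_exists, not_and, not_lt] at hsmall
  exact hω (hsub _ hsmall)

variable [hp : Fact p.Prime]

theorem char_solenoidLine (χ : PontryaginDual (solenoid p)) (t : ℝ) :
    χ (solenoidLine p hp.out.ne_zero t) = Circle.exp (solenoidFreq p χ * t) := by
  obtain ⟨d, l, rfl⟩ := exists_eq_solenoidChar p hp.out.ne_zero χ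
  rw [solenoidFreq_solenoidChar, solenoidChar_apply, solenoidLine_coe, ← Circle.exp_intCast_mul]
  congr 1
  ring

variable (p)

theorem exists_isGaussMeasure {b : ℝ} (hb : 0 ≤ b) :
    ∃ γ : ProbabilityMeasure (solenoid p), IsGaussMeasure (solenoidQuadraticForm p b) γ := by
  have hline := (continuous_solenoidLine p hp.out.ne_zero).aemeasurable
    (μ := gaussianReal 0 b.toNNReal)
  refine ⟨⟨(gaussianReal 0 b.toNNReal).map (solenoidLine p hp.out.ne_zero),
    Measure.isProbabilityMeasure_map hline⟩, fun χ => ?_⟩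
  rw [ProbabilityMeasure.coe_mk, fourierTransform_map hline]
  simp only [char_solenoidLine, Circle.coe_exp, Complex.ofReal_mul]
  rw [← charFun_apply_real, charFun_gaussianReal, Real.coe_toNNReal b hb, solenoidQuadraticForm]
  congr 1
  push_cast
  ring

theorem eventually_char_eq_exp_solenoidInner (χ : PontryaginDual (solenoid p)) :
    ∀ᶠ y in 𝓝 1, (χ y : ℂ) = Complex.exp (Complex.I * solenoidInner p y χ) := by
  obtain ⟨d, l, rfl⟩ := exists_eq_solenoidChar p hp.out.ne_zero χ
  have hpd : (0 : ℝ) < (p : ℝ) ^ d := pow_pos (by exact_mod_cast hp.out.pos) d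
  have harg : ContinuousAt (fun y : solenoid p => Complex.arg ((y : ℕ → Circle) d)) 1 :=
    ContinuousAt.comp (Complex.continuousAt_arg (by simp))
      (continuous_subtype_val.comp (continuous_solenoid_apply p d)).continuousAt
  have hsmall : ∀ᶠ y : solenoid p in 𝓝 1,
      |(p : ℝ) ^ d * Complex.arg ((y : ℕ → Circle) d)| < Real.pi / 2 :=
    (harg.const_mul _).abs.eventually_lt continuousAt_const (by simp [Real.pi_pos])
  filter_upwards [hsmall] with y hy
  set s := Complex.arg ((y : ℕ → Circle) d : ℂ)
  have hyd : (y : ℕ → Circle) d = Circle.exp s := (Circle.exp_arg _).symm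
  have hy0 : (y : ℕ → Circle) 0 = Circle.exp ((p : ℝ) ^ d * s) := by
    rw [solenoid_apply_zero_eq_pow y d, hyd, ← Circle.exp_natCast_mul, Nat.cast_pow]
  rw [solenoidInner_solenoidChar, hy0, truncH_circleArg_exp hy.le, solenoidChar_apply, hyd,
    ← Circle.exp_intCast_mul, Circle.coe_exp, mul_comm]
  congr 3
  field_simp

theorem isLocalLogarithm_solenoidInner : IsLocalLogarithm (solenoidInner p) where
  continuous χ :=
    (continuous_truncH_circleArg.comp (continuous_solenoid_apply p 0)).const_mul _
  apply_one χ := by simp [solenoidInner, truncH_circleArg]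
  char_eq_exp χ := eventually_char_eq_exp_solenoidInner p χ

theorem exists_isGeneralizedPoisson_solenoidInner {η : Measure (solenoid p)}
    (hη : IsLevyMeasure η) :
    ∃ π : ProbabilityMeasure (solenoid p), IsGeneralizedPoisson η (solenoidInner p) π := by
  refine (isLocalLogarithm_solenoidInner p).exists_isGeneralizedPoisson hη fun ν _ =>
    ⟨solenoidLine p hp.out.ne_zero (∫ y, truncH (circleArg ((y : ℕ → Circle) 0)) ∂ν), fun χ => ?_⟩
  simp only [solenoidInner]
  rw [char_solenoidLine, Circle.coe_exp, integral_const_mul, mul_comm]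

variable {p} {Ω : ℕ → Type*} [∀ n, MeasurableSpace (Ω n)] {P : ∀ n, Measure (Ω n)} {K : ℕ → ℕ}
  {X : ∀ n, Fin (K n) → Ω n → solenoid p}

theorem tendsto_exp_sum_integral_solenoidInner {a : solenoid p}
    (h : ∀ d : ℕ, Tendsto (fun n => Complex.exp (Complex.I / (p : ℂ) ^ d *
      ((∑ k, ∫ ω, truncH (circleArg ((X n k ω : ℕ → Circle) 0)) ∂P n : ℝ) : ℂ))) atTop
      (𝓝 ((a : ℕ → Circle) d)))
    (χ : PontryaginDual (solenoid p)) :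
    Tendsto (fun n => Complex.exp (Complex.I * (∑ k, ∫ ω, solenoidInner p (X n k ω) χ ∂P n : ℝ)))
      atTop (𝓝 (χ a)) := by
  obtain ⟨d, l, rfl⟩ := exists_eq_solenoidChar p hp.out.ne_zero χ
  rw [solenoidChar_apply, Circle.coe_zpow]
  refine ((h d).zpow₀ l (.inl (Circle.coe_ne_zero _))).congr fun n => ?_
  simp only [solenoidInner, solenoidFreq_solenoidChar, integral_const_mul, ← Finset.mul_sum]
  rw [← Complex.exp_int_mul]
  congr 1
  push_cast
  ring

theorem tendsto_sum_variance_solenoidInner {b : ℝ} {η : Measure (solenoid p)}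
    (h : Tendsto (fun n => ∑ k, Var[fun ω => truncH (circleArg ((X n k ω : ℕ → Circle) 0)); P n])
      atTop (𝓝 (b + ∫ y : solenoid p, truncH (circleArg ((y : ℕ → Circle) 0)) ^ 2 ∂η)))
    (χ : PontryaginDual (solenoid p)) :
    Tendsto (fun n => ∑ k, Var[fun ω => solenoidInner p (X n k ω) χ; P n]) atTop
      (𝓝 (solenoidQuadraticForm p b χ + ∫ y, solenoidInner p y χ ^ 2 ∂η)) := by
  simp only [solenoidInner, solenoidQuadraticForm, variance_const_mul, mul_pow,
    integral_const_mul, ← Finset.mul_sum]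
  rw [mul_comm b, ← mul_add]
  exact h.const_mul _

end Solenoid

theorem mainTheorem10 (p : ℕ) [Fact p.Prime]
    {Ω : ℕ → Type*} [∀ n, MeasurableSpace (Ω n)]
    (P : ∀ n, Measure (Ω n)) [∀ n, IsProbabilityMeasure (P n)]
    (K : ℕ → ℕ) (X : ∀ n, Fin (K n) → Ω n → solenoid p)
    (hmeas : ∀ n k, Measurable (X n k))
    (hindep : ∀ n, iIndepFun (X n) (P n))
    (a : solenoid p) (b : ℝ) (hb : 0 ≤ b)
    (η : Measure (solenoid p)) (hη : IsLevyMeasure η)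
    (h_i : ∀ (d : ℕ) (ε : ℝ), 0 < ε →
      Tendsto (fun n => ⨆ k : Fin (K n),
        P n {ω | ∃ j ≤ d, ε < |circleArg ((X n k ω : ℕ → Circle) j)|}) atTop (𝓝 0))
    (h_ii : ∀ d : ℕ,
      Tendsto (fun n => Complex.exp (Complex.I / (p : ℂ) ^ d *
        ((∑ k : Fin (K n), ∫ ω, truncH (circleArg ((X n k ω : ℕ → Circle) 0)) ∂(P n) : ℝ) : ℂ)))
        atTop (𝓝 ((a : ℕ → Circle) d : ℂ)))
    (h_iii : Tendsto (fun n => ∑ k : Fin (K n),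
        variance (fun ω => truncH (circleArg ((X n k ω : ℕ → Circle) 0))) (P n)) atTop
      (𝓝 (b + ∫ y : solenoid p, truncH (circleArg ((y : ℕ → Circle) 0)) ^ 2 ∂η)))
    (h_iv : ∀ f : solenoid p →ᵇ ℝ, (∃ U ∈ 𝓝 (1 : solenoid p), ∀ y ∈ U, f y = 0) →
      Tendsto (fun n => ∑ k : Fin (K n), ∫ ω, f (X n k ω) ∂(P n)) atTop (𝓝 (∫ y, f y ∂η))) :
    IsInfinitesimalArray P K X ∧
      (∃! γ : ProbabilityMeasure (solenoid p), IsGaussMeasure (solenoidQuadraticForm p b) γ) ∧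
      (∃! π : ProbabilityMeasure (solenoid p), IsGeneralizedPoisson η (solenoidInner p) π) ∧
      ∀ γ π : ProbabilityMeasure (solenoid p),
        IsGaussMeasure (solenoidQuadraticForm p b) γ →
        IsGeneralizedPoisson η (solenoidInner p) π →
        TendstoInDistribution (fun n ω => ∏ k : Fin (K n), X n k ω) atTop id P
          (Measure.dirac a ∗ₘ (γ : Measure (solenoid p)) ∗ₘ (π : Measure (solenoid p))) := by
  have hinf := isInfinitesimalArray_of_tendsto_circleArg h_i
  have hsep := injective_char_solenoid p
  obtain ⟨γ₀, hγ₀⟩ := exists_isGaussMeasure p hb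
  obtain ⟨π₀, hπ₀⟩ := exists_isGeneralizedPoisson_solenoidInner p hη
  exact ⟨hinf, ⟨γ₀, hγ₀, fun γ hγ => hγ.unique hsep hγ₀⟩,
    ⟨π₀, hπ₀, fun π hπ => hπ.unique hsep hπ₀⟩, fun γ π hγ hπ =>
      hinf.tendstoInDistribution_prod hsep hmeas hindep (isLocalLogarithm_solenoidInner p) hη
        (tendsto_exp_sum_integral_solenoidInner h_ii) (tendsto_sum_variance_solenoidInner h_iii)
        (tendstoAwayFrom_entryLaw hmeas h_iv) hγ hπ⟩
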